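/- Let $p\in\mathbb C[x]$ be a nonzero polynomial of degree $n$ and let $c\in\mathbb C$ be such that $p(x)=(-1)^n p(-x+c)$. Let $\mathcal D^a$ be the associative algebra of differential operators $\sum_k t^k f_k(D)$ on $\mathbb C[t,t^{-1}]$ (finite sums, $k\in\mathbb Z$, $f_k\in\mathbb C[x]$, $D=t\frac{d}{dt}$), and let $\widehat{\mathcal D}=\mathcal D\oplus\mathbb C C$ be the central extension of the corresponding Lie algebra $\mathcal D$ by the antisymmetric 2-cocycle $$\Psi(t^rf(D),t^sg(D))=\sum_{-r\le m\le -1}f(m)g(m+r)\ \text{ if } r=-s>0,\qquad \Psi(t^rf(D),t^sg(D))=0\ \text{ if } r+s\ne0 \text{ or } r=s=0.$$ For each choice of sign let $\sigma_\pm$ be the anti-involution $\sigma_\pm(t^kf(D)p(D))=(-1)^n(\pm t)^kf(-D-k+c)p(D)$ of $\mathcal D^a p(D)$, let $\mathcal D_p^\pm=\{d\in\mathcal D^a p(D):\sigma_\pm(d)=-d\}$, a Lie subalgebra of $\mathcal D$, and let $\widehat{\mathcal D}_p^\pm=\mathcal D_p^\pm\oplus\mathbb C C\subset\widehat{\mathcal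 D}$, with the $\mathbb Z$-gradation in which $t^kf(D)p(D)$ has degree $k$ and $C$ has degree $0$. Let $\lambda$ be a linear functional on $(\widehat{\mathcal D}_p^\pm)_0$ and let $L(\widehat{\mathcal D}_p^\pm,\lambda)$ be the irreducible highest weight module, i.e. the quotient of the Verma module of highest weight $\lambda$ by its maximal proper graded submodule. It is called quasifinite if all its homogeneous components are finite-dimensional. Put $\Delta_l=-\lambda\big((D-\tfrac c2)^l\,p(D)\big)$ for the integers $l\ge0$ with $l+n$ odd, and let $\Delta_\lambda(x)=\sum_l \Delta_l\,\frac{x^l}{l!}$, the sum over these $l$, as a formal power series. Then $L(\widehat{\mathcal D}_p^{\pm},\lambda)$ is quasifinite if and only if there is an even quasipolynomial $\phi_\lambda$ (an even linear combination of functions $q(x)e^{\alpha x}$ with $q\in\mathbb C[x]$, $\alpha\in\mathbb C$) with $\phi_\lambda(0)=0$ such that $$\Delta_\lambda(x)=p\Big(\frac{d}{dx}+\frac c2\Big)\left(\frac{\phi_\lambda(x)}{2\sinh(x/2)}\right).$$ -/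

import Mathlib

open Polynomial

namespace CircleOp

/-! ### The associative algebra of regular differential operators on the circle -/

/-- Regular differential operators on the circle in normal form: the finitely supported family
`(f k)` stands for the operator `∑ k, t ^ k * (f k) (D)`, where `D = t * d/dt`. -/
def DiffOp : Type := ℤ →₀ ℂ[X]

noncomputable instance : AddCommGroup DiffOp := inferInstanceAs (AddCommGroup (ℤ →₀ ℂ[X]))

noncomputable instance : Module ℂ DiffOp := inferInstanceAs (Module ℂ (ℤ →₀ ℂ[X]))

/-- `mon k f` is the operator `t ^ k f(D)`. -/
noncomputable def mon (k : ℤ) : ℂ[X] →ₗ[ℂ] DiffOp := Finsupp.lsingle k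

theorem induction_mon {P : DiffOp → Prop} (a : DiffOp) (h0 : P 0)
    (hadd : ∀ a b, P a → P b → P (a + b)) (hmon : ∀ k f, P (mon k f)) : P a :=
  Finsupp.induction_linear a h0 hadd hmon

/-- The linear map on operators that takes the value `F k f` on `t ^ k f(D)`. -/
noncomputable def lift {V : Type*} [AddCommGroup V] [Module ℂ V] (F : ℤ → ℂ[X] →ₗ[ℂ] V) :
    DiffOp →ₗ[ℂ] V := Finsupp.lsum ℂ F

theorem lift_mon {V : Type*} [AddCommGroup V] [Module ℂ V] (F : ℤ → ℂ[X] →ₗ[ℂ] V) (k : ℤ)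
    (f : ℂ[X]) : lift F (mon k f) = F k f :=
  Finsupp.lsum_single ℂ F k f

/-- The bilinear map on operators that takes the value `B r s f g` on `t ^ r f(D)`,
`t ^ s g(D)`. -/
noncomputable def bilin {V : Type*} [AddCommGroup V] [Module ℂ V]
    (B : ℤ → ℤ → ℂ[X] →ₗ[ℂ] ℂ[X] →ₗ[ℂ] V) : DiffOp →ₗ[ℂ] DiffOp →ₗ[ℂ] V :=
  lift fun r => LinearMap.flip (lift fun s => LinearMap.flip (B r s))

theorem bilin_mon {V : Type*} [AddCommGroup V] [Module ℂ V]
    (B : ℤ → ℤ → ℂ[X] →ₗ[ℂ] ℂ[X] →ₗ[ℂ] V) (r s : ℤ) (f g : ℂ[X]) :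
    bilin B (mon r f) (mon s g) = B r s f g := by
  rw [bilin, lift_mon, LinearMap.flip_apply, lift_mon, LinearMap.flip_apply]

/-- Composition of operators, determined by `f(D) t ^ s = t ^ s f(D + s)`. -/
noncomputable def mulBilin : DiffOp →ₗ[ℂ] DiffOp →ₗ[ℂ] DiffOp :=
  bilin fun r s =>
    ((LinearMap.mul ℂ ℂ[X]).comp (taylor (s : ℂ))).compr₂ (mon (r + s))

noncomputable instance : Mul DiffOp := ⟨fun a b => mulBilin a b⟩

noncomputable instance : One DiffOp := ⟨mon 0 1⟩

theorem mul_def (a b : DiffOp) : a * b = mulBilin a b := rfl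

theorem one_def : (1 : DiffOp) = mon 0 1 := rfl

/-- `t ^ r f(D) * t ^ s g(D) = t ^ (r + s) f(D + s) g(D)`. -/
theorem mon_mul_mon (r s : ℤ) (f g : ℂ[X]) :
    mon r f * mon s g = mon (r + s) (f.comp (X + C (s : ℂ)) * g) := by
  rw [mul_def, mulBilin, bilin_mon]
  rfl

private theorem left_distrib' (a b c : DiffOp) : a * (b + c) = a * b + a * c := by
  simp only [mul_def, map_add]

private theorem right_distrib' (a b c : DiffOp) : (a + b) * c = a * c + b * c := by
  simp only [mul_def, map_add, LinearMap.add_apply]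

private theorem zero_mul' (a : DiffOp) : 0 * a = 0 := by
  simp only [mul_def, map_zero, LinearMap.zero_apply]

private theorem mul_zero' (a : DiffOp) : a * 0 = 0 := by
  simp only [mul_def, map_zero]

private theorem mul_assoc' (a b c : DiffOp) : a * b * c = a * (b * c) := by
  induction a using induction_mon with
  | h0 => simp only [zero_mul']
  | hadd a a' h h' => simp only [right_distrib', h, h']
  | hmon r f =>
    induction b using induction_mon with
    | h0 => simp only [zero_mul', mul_zero']
    | hadd b b' h h' => simp only [right_distrib', left_distrib', h, h']
    | hmon s g =>
      induction c using induction_mon with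
      | h0 => simp only [mul_zero']
      | hadd c c' h h' => simp only [left_distrib', h, h']
      | hmon u h =>
        simp only [mon_mul_mon, mul_comp, comp_assoc, add_comp, X_comp, C_comp, Int.cast_add,
          C_add, add_assoc, mul_assoc, add_comm (C (u : ℂ)) (C (s : ℂ))]

noncomputable instance : Ring DiffOp where
  __ := (inferInstance : AddCommGroup DiffOp)
  left_distrib := left_distrib'
  right_distrib := right_distrib'
  zero_mul := zero_mul'
  mul_zero := mul_zero'
  mul_assoc := mul_assoc'
  one_mul a := by
    induction a using induction_mon with
    | h0 => exact mul_zero' _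
    | hadd a b h h' => rw [left_distrib', h, h']
    | hmon k f => rw [one_def, mon_mul_mon, one_comp, one_mul, zero_add]
  mul_one a := by
    induction a using induction_mon with
    | h0 => exact zero_mul' _
    | hadd a b h h' => rw [right_distrib', h, h']
    | hmon k f => rw [one_def, mon_mul_mon]; simp

noncomputable instance : Algebra ℂ DiffOp :=
  Algebra.ofModule
    (fun z a b => by simp only [mul_def, map_smul, LinearMap.smul_apply])
    (fun z a b => by simp only [mul_def, map_smul])

/-- The Lie algebra `𝒟` of differential operators, with the commutator bracket. -/
noncomputable instance : LieRing DiffOp := LieRing.ofAssociativeRing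

noncomputable instance : LieAlgebra ℂ DiffOp := LieAlgebra.ofAssociativeAlgebra

theorem lie_def (a b : DiffOp) : ⁅a, b⁆ = a * b - b * a := rfl

/-! ### The central extension -/

/-- The value of the cocycle on `t ^ r f(D)`, `t ^ s g(D)`: it is
`∑ m ∈ {-r, …, -1}, f(m) g(m + r)` if `r = -s > 0`, it vanishes if `r + s ≠ 0` or `r = s = 0`, and
it is extended to `r = -s < 0` by antisymmetry. -/
noncomputable def psiMon (r s : ℤ) : ℂ[X] →ₗ[ℂ] ℂ[X] →ₗ[ℂ] ℂ :=
  LinearMap.mk₂ ℂ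
    (fun f g => if r + s = 0 then
        (∑ m ∈ Finset.Ico (-r) 0, f.eval (m : ℂ) * g.eval ((m + r : ℤ) : ℂ))
        - ∑ m ∈ Finset.Ico (-s) 0, g.eval (m : ℂ) * f.eval ((m + s : ℤ) : ℂ)
      else 0)
    (fun f f' g => by
      split_ifs
      · simp only [eval_add, add_mul, mul_add, Finset.sum_add_distrib]; ring
      · simp)
    (fun z f g => by
      split_ifs
      · simp only [eval_smul, smul_eq_mul, mul_sub, Finset.mul_sum]
        congr 1 <;> exact Finset.sum_congr rfl fun m _ => by ring
      · simp)
    (fun f g g' => by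
      split_ifs
      · simp only [eval_add, add_mul, mul_add, Finset.sum_add_distrib]; ring
      · simp)
    (fun z f g => by
      split_ifs
      · simp only [eval_smul, smul_eq_mul, mul_sub, Finset.mul_sum]
        congr 1 <;> exact Finset.sum_congr rfl fun m _ => by ring
      · simp)

/-- The 2-cocycle `Ψ` on `𝒟`. -/
noncomputable def psi : DiffOp →ₗ[ℂ] DiffOp →ₗ[ℂ] ℂ := bilin psiMon

theorem psi_mon (r s : ℤ) (f g : ℂ[X]) :
    psi (mon r f) (mon s g) = if r + s = 0 then
        (∑ m ∈ Finset.Ico (-r) 0, f.eval (m : ℂ) * g.eval ((m + r : ℤ) : ℂ))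
        - ∑ m ∈ Finset.Ico (-s) 0, g.eval (m : ℂ) * f.eval ((m + s : ℤ) : ℂ)
      else 0 := by
  rw [psi, bilin_mon]; rfl

theorem psi_antisymm (a b : DiffOp) : psi a b = -psi b a := by
  induction a using induction_mon with
  | h0 => simp
  | hadd a a' h h' => simp only [map_add, LinearMap.add_apply, h, h']; ring
  | hmon r f =>
    induction b using induction_mon with
    | h0 => simp
    | hadd b b' h h' => simp only [map_add, LinearMap.add_apply, h, h']; ring
    | hmon s g =>
      rw [psi_mon, psi_mon, add_comm s r]
      split_ifs <;> ring

theorem psi_self (a : DiffOp) : psi a a = 0 := by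
  have h := psi_antisymm a a
  linear_combination h / 2

private theorem sum_Ico_succ_right (F : ℤ → ℂ) (a b : ℤ) (h : a ≤ b) :
    ∑ m ∈ Finset.Ico a (b + 1), F m = ∑ m ∈ Finset.Ico a b, F m + F b := by
  have : Finset.Ico a (b + 1) = insert b (Finset.Ico a b) := by ext x; simp; omega
  rw [this, Finset.sum_insert (by simp)]
  ring

private theorem sum_Ico_succ_left (F : ℤ → ℂ) (a b : ℤ) (h : a < b) :
    ∑ m ∈ Finset.Ico a b, F m = F a + ∑ m ∈ Finset.Ico (a + 1) b, F m := by
  have : Finset.Ico a b = insert a (Finset.Ico (a + 1) b) := by ext x; simp; omega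
  rw [this, Finset.sum_insert (by simp)]

private theorem sum_tele_le (F Q : ℤ → ℂ) (hQ : ∀ m, Q (m + 1) - Q m = F m) (a b : ℤ)
    (hab : a ≤ b) : ∑ m ∈ Finset.Ico a b, F m = Q b - Q a := by
  induction b, hab using Int.leInduction with
  | base => simp
  | succ b hb ih =>
    rw [sum_Ico_succ_right F a b hb, ih, ← hQ b]
    ring

private theorem sum_tele (F Q : ℤ → ℂ) (hQ : ∀ m, Q (m + 1) - Q m = F m) (a b : ℤ) :
    (∑ m ∈ Finset.Ico a b, F m) - ∑ m ∈ Finset.Ico b a, F m = Q b - Q a := by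
  rcases le_total a b with h | h
  · rw [sum_tele_le F Q hQ a b h, Finset.Ico_eq_empty (by omega : ¬ b < a)]; simp
  · rw [sum_tele_le F Q hQ b a h, Finset.Ico_eq_empty (by omega : ¬ a < b)]; simp

private theorem exists_primitive (F : ℤ → ℂ) : ∃ Q : ℤ → ℂ, ∀ m, Q (m + 1) - Q m = F m := by
  refine ⟨fun m => (∑ k ∈ Finset.Ico 0 m, F k) - ∑ k ∈ Finset.Ico m 0, F k, fun m => ?_⟩
  beta_reduce
  rcases le_or_gt 0 m with h | h
  · rw [sum_Ico_succ_right F 0 m h, Finset.Ico_eq_empty (by omega : ¬ m < 0),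
      Finset.Ico_eq_empty (by omega : ¬ m + 1 < 0)]
    simp
  · rw [sum_Ico_succ_left F m 0 h, Finset.Ico_eq_empty (by omega : ¬ 0 < m),
      Finset.Ico_eq_empty (by omega : ¬ 0 < m + 1)]
    simp

private theorem psi_mon_eq (r s : ℤ) (hrs : r + s = 0) (f g : ℂ[X]) (Q : ℤ → ℂ)
    (hQ : ∀ m : ℤ, Q (m + 1) - Q m = f.eval (m : ℂ) * g.eval ((m + r : ℤ) : ℂ)) :
    psi (mon r f) (mon s g) = Q 0 - Q (-r) := by
  obtain rfl : s = -r := by omega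
  rw [psi_mon, if_pos hrs, ← sum_tele _ Q hQ]
  congr 1
  refine Finset.sum_bij' (fun m _ => m - r) (fun m _ => m + r) ?_ ?_ ?_ ?_ ?_
  · intro m hm; simp at hm ⊢; omega
  · intro m hm; simp at hm ⊢; omega
  · intro m hm; ring
  · intro m hm; ring
  · intro m hm
    rw [show m - r + r = m by ring, show m + -r = m - r by ring]; ring

private theorem psi_cyclic_mon (r s u : ℤ) (f g h : ℂ[X]) :
    psi (mon r f * mon s g) (mon u h) + psi (mon s g * mon u h) (mon r f)
      + psi (mon u h * mon r f) (mon s g) = 0 := by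
  simp only [mon_mul_mon]
  by_cases hz : r + s + u = 0
  · obtain ⟨Q, hQ⟩ := exists_primitive fun m =>
      f.eval ((m + s : ℤ) : ℂ) * g.eval (m : ℂ) * h.eval ((m + r + s : ℤ) : ℂ)
    rw [psi_mon_eq (r + s) u hz _ _ Q, psi_mon_eq (s + u) r (by omega) _ _ (fun m => Q (m + u)),
      psi_mon_eq (u + r) s (by omega) _ _ (fun m => Q (m - s))]
    · rw [show -(r + s) = u by omega, show -(s + u) + u = -s by omega,
        show -(u + r) - s = 0 by omega, zero_add, zero_sub]
      ring
    · intro m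
      rw [show m + 1 - s = m - s + 1 by ring, hQ]
      obtain rfl : u = -r - s := by omega
      simp only [eval_mul, eval_comp, eval_add, eval_X, eval_C]
      push_cast
      ring_nf
    · intro m
      rw [show m + 1 + u = m + u + 1 by ring, hQ]
      obtain rfl : u = -r - s := by omega
      simp only [eval_mul, eval_comp, eval_add, eval_X, eval_C]
      push_cast
      ring_nf
    · intro m
      rw [hQ]
      simp only [eval_mul, eval_comp, eval_add, eval_X, eval_C]
      push_cast
      ring_nf
  · rw [psi_mon, psi_mon, psi_mon, if_neg hz, if_neg (by omega), if_neg (by omega)]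
    simp

private theorem psi_cyclic (a b c : DiffOp) :
    psi (a * b) c + psi (b * c) a + psi (c * a) b = 0 := by
  induction a using induction_mon with
  | h0 => simp
  | hadd a a' h h' =>
    simp only [add_mul, mul_add, map_add, LinearMap.add_apply]; linear_combination h + h'
  | hmon r f =>
    induction b using induction_mon with
    | h0 => simp
    | hadd a a' h h' =>
      simp only [add_mul, mul_add, map_add, LinearMap.add_apply]; linear_combination h + h'
    | hmon s g =>
      induction c using induction_mon with
      | h0 => simp
      | hadd a a' h h' =>
        simp only [add_mul, mul_add, map_add, LinearMap.add_apply]; linear_combination h + h'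
      | hmon u h => exact psi_cyclic_mon r s u f g h

theorem psi_cocycle (a b c : DiffOp) :
    psi ⁅a, b⁆ c + psi ⁅b, c⁆ a + psi ⁅c, a⁆ b = 0 := by
  simp only [lie_def, map_sub, LinearMap.sub_apply]
  linear_combination psi_cyclic a b c - psi_cyclic b a c

/-- The central extension `𝒟 + ℂ C`; the pair `(a, z)` stands for `a + z C`. -/
def DHat : Type := DiffOp × ℂ

noncomputable instance : AddCommGroup DHat := inferInstanceAs (AddCommGroup (DiffOp × ℂ))

noncomputable instance : Module ℂ DHat := inferInstanceAs (Module ℂ (DiffOp × ℂ))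

/-- `[a + z C, b + w C] = [a, b] + Ψ(a, b) C`. -/
noncomputable instance : Bracket DHat DHat := ⟨fun x y => (⁅x.1, y.1⁆, psi x.1 y.1)⟩

theorem DHat.lie_def (x y : DHat) : ⁅x, y⁆ = (⁅x.1, y.1⁆, psi x.1 y.1) := rfl

noncomputable instance : LieRing DHat where
  add_lie x y z := by
    refine Prod.ext ?_ ?_
    · exact add_lie x.1 y.1 z.1
    · exact LinearMap.map_add₂ psi x.1 y.1 z.1
  lie_add x y z := by
    refine Prod.ext ?_ ?_
    · exact lie_add x.1 y.1 z.1
    · exact map_add (psi x.1) y.1 z.1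
  lie_self x := by
    refine Prod.ext ?_ ?_
    · exact lie_self x.1
    · exact psi_self x.1
  leibniz_lie x y z := by
    refine Prod.ext ?_ ?_
    · exact leibniz_lie x.1 y.1 z.1
    · change psi x.1 ⁅y.1, z.1⁆ = psi ⁅x.1, y.1⁆ z.1 + psi y.1 ⁅x.1, z.1⁆
      have h := psi_cocycle x.1 y.1 z.1
      have h1 := psi_antisymm x.1 ⁅y.1, z.1⁆
      have h2 := psi_antisymm y.1 ⁅x.1, z.1⁆
      have h3 : psi ⁅z.1, x.1⁆ y.1 = -psi ⁅x.1, z.1⁆ y.1 := by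
        rw [← lie_skew, map_neg, LinearMap.neg_apply]
      linear_combination h1 - h2 + h3 - h

noncomputable instance : LieAlgebra ℂ DHat where
  lie_smul z x y := by
    refine Prod.ext ?_ ?_
    · exact lie_smul z x.1 y.1
    · exact map_smul (psi x.1) z y.1

/-- The projection of the central extension onto `𝒟`. -/
noncomputable def proj : DHat →ₗ⁅ℂ⁆ DiffOp where
  toFun x := x.1
  map_add' _ _ := rfl
  map_smul' _ _ := rfl
  map_lie' := rfl

/-- The homogeneous component of degree `k` of the central extension, where `t ^ k f(D)` has
degree `k` and `C` has degree `0`. -/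
noncomputable def hatGrade (k : ℤ) : Submodule ℂ DHat where
  carrier := {x | (∃ f : ℂ[X], x.1 = mon k f) ∧ (k ≠ 0 → x.2 = 0)}
  add_mem' := by
    rintro x y ⟨⟨f, hf⟩, hx⟩ ⟨⟨g, hg⟩, hy⟩
    refine ⟨⟨f + g, ?_⟩, fun hk => ?_⟩
    · rw [map_add, ← hf, ← hg]; rfl
    · change x.2 + y.2 = 0
      rw [hx hk, hy hk, add_zero]
  zero_mem' := ⟨⟨0, by rw [map_zero]; rfl⟩, fun _ => rfl⟩
  smul_mem' := by
    rintro z x ⟨⟨f, hf⟩, hx⟩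
    refine ⟨⟨z • f, ?_⟩, fun hk => ?_⟩
    · rw [map_smul, ← hf]; rfl
    · change z • x.2 = 0
      rw [hx hk, smul_zero]

/-! ### The subalgebras fixed by minus an anti-involution -/

/-- The condition `p(x) = (-1) ^ deg p * p(-x + c)`. -/
def IsSymmetricAbout (p : ℂ[X]) (c : ℂ) : Prop :=
  p = (-1) ^ p.natDegree * p.comp (-X + C c)

/-- The linear map `t ^ k f(D) ↦ (-1) ^ deg p * (± t) ^ k f(-D - k + c)`, the sign being `s`. -/
noncomputable def sigmaZero (p : ℂ[X]) (c : ℂ) (s : ℤˣ) : DiffOp →ₗ[ℂ] DiffOp :=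
  lift fun k : ℤ =>
    ((-1) ^ p.natDegree * (((s ^ k : ℤˣ) : ℤ) : ℂ)) •
      (mon k).comp (aeval (-X - C (k : ℂ) + C c) : ℂ[X] →ₐ[ℂ] ℂ[X]).toLinearMap

theorem sigmaZero_mon (p : ℂ[X]) (c : ℂ) (s : ℤˣ) (k : ℤ) (f : ℂ[X]) :
    sigmaZero p c s (mon k f) = ((-1) ^ p.natDegree * (((s ^ k : ℤˣ) : ℤ) : ℂ)) •
      mon k (f.comp (-X - C (k : ℂ) + C c)) := by
  rw [sigmaZero, lift_mon]
  rfl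

private theorem sigmaZero_mon' (p : ℂ[X]) (c : ℂ) (s : ℤˣ) (k : ℤ) (f : ℂ[X]) :
    sigmaZero p c s (mon k f) = mon k (C ((-1) ^ p.natDegree * (((s ^ k : ℤˣ) : ℤ) : ℂ)) *
      f.comp (-X - C (k : ℂ) + C c)) := by
  rw [sigmaZero_mon, ← map_smul, smul_eq_C_mul]

private theorem sigmaZero_mul (p : ℂ[X]) (c : ℂ) (s : ℤˣ) (hc : IsSymmetricAbout p c)
    (a b : DiffOp) : sigmaZero p c s (a * mon 0 p * b) =
      sigmaZero p c s b * mon 0 p * sigmaZero p c s a := by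
  induction a using induction_mon with
  | h0 => simp
  | hadd a a' h h' => simp only [add_mul, mul_add, map_add, h, h']
  | hmon r f =>
    induction b using induction_mon with
    | h0 => simp
    | hadd b b' h h' => simp only [add_mul, mul_add, map_add, h, h']
    | hmon u g =>
      have hs : (((s ^ (r + u) : ℤˣ) : ℤ) : ℂ) =
          (((s ^ r : ℤˣ) : ℤ) : ℂ) * (((s ^ u : ℤˣ) : ℤ) : ℂ) := by
        rw [zpow_add]; push_cast; ring
      have he : p.comp (X + C (r : ℂ)) =
          (-1) ^ p.natDegree * p.comp (-X - C (r : ℂ) + C c) := by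
        conv_lhs => rw [show p = (-1) ^ p.natDegree * p.comp (-X + C c) from hc]
        simp only [mul_comp, pow_comp, neg_comp, one_comp, comp_assoc, add_comp, X_comp, C_comp]
        congr 2
        ring
      have h1 : ((mon r f * mon 0 p) * mon u g) =
          mon (r + u) (f.comp (X + C (u : ℂ)) * p.comp (X + C (u : ℂ)) * g) := by
        rw [mon_mul_mon, mon_mul_mon]; simp
      have h2 (z w : ℂ) : mon u (C z * g.comp (-X - C (u : ℂ) + C c)) * mon 0 p *
          mon r (C w * f.comp (-X - C (r : ℂ) + C c)) =
          mon (r + u) (C z * g.comp (-X - C ((r + u : ℤ) : ℂ) + C c) * p.comp (X + C (r : ℂ)) *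
            (C w * f.comp (-X - C (r : ℂ) + C c))) := by
        have : (-(X + C (r : ℂ)) - C (u : ℂ) + C c : ℂ[X]) = -X - C ((r + u : ℤ) : ℂ) + C c := by
          rw [Int.cast_add, C_add]; ring
        rw [mon_mul_mon, mon_mul_mon, add_zero, add_comm u r, Int.cast_zero, C_0, add_zero, comp_X]
        simp only [mul_comp, comp_assoc, add_comp, sub_comp, neg_comp, X_comp, C_comp, this]
      have h3 : ((f.comp (X + C (u : ℂ)) * p.comp (X + C (u : ℂ)) * g).comp
          (-X - C ((r + u : ℤ) : ℂ) + C c)) =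
          f.comp (-X - C (r : ℂ) + C c) * p.comp (-X - C (r : ℂ) + C c) *
            g.comp (-X - C ((r + u : ℤ) : ℂ) + C c) := by
        have : (-X - C ((r + u : ℤ) : ℂ) + C c + C (u : ℂ) : ℂ[X]) = -X - C (r : ℂ) + C c := by
          rw [Int.cast_add, C_add]; ring
        simp only [mul_comp, comp_assoc, add_comp, X_comp, C_comp, this]
      rw [h1, sigmaZero_mon', sigmaZero_mon', sigmaZero_mon', h2, h3, he, hs]
      congr 1
      generalize f.comp _ = f'
      generalize g.comp _ = g'
      generalize p.comp _ = p'
      have hsq : ((-1 : ℂ[X]) ^ p.natDegree) * (-1) ^ p.natDegree = 1 := by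
        rw [← mul_pow]; simp
      simp only [C_mul, C_pow, C_neg, C_1]
      generalize (-1 : ℂ[X]) ^ p.natDegree = e at hsq
      linear_combination (-(e * C (((s ^ r : ℤˣ) : ℤ) : ℂ) * C (((s ^ u : ℤˣ) : ℤ) : ℂ)
        * f' * g' * p')) * hsq

/-- The Lie algebra `𝒟_p^±`: the elements `d = a p(D)` of `𝒟_p` with `σ(d) = -d`, where
`σ(a p(D)) = σ₀(a) p(D)`. -/
noncomputable def DpSub (p : ℂ[X]) (c : ℂ) (s : ℤˣ) (hc : IsSymmetricAbout p c) :
    LieSubalgebra ℂ DiffOp where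
  carrier := {d | ∃ a : DiffOp, d = a * mon 0 p ∧ sigmaZero p c s a * mon 0 p = -d}
  add_mem' := by
    rintro _ _ ⟨a, rfl, ha⟩ ⟨b, rfl, hb⟩
    exact ⟨a + b, by rw [add_mul], by rw [map_add, add_mul, ha, hb, neg_add]⟩
  zero_mem' := ⟨0, by simp, by simp⟩
  smul_mem' := by
    rintro z _ ⟨a, rfl, ha⟩
    exact ⟨z • a, by rw [smul_mul_assoc], by rw [map_smul, smul_mul_assoc, ha, smul_neg]⟩
  lie_mem' := by
    rintro _ _ ⟨a, rfl, ha⟩ ⟨b, rfl, hb⟩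
    refine ⟨a * mon 0 p * b - b * mon 0 p * a, ?_, ?_⟩
    · rw [lie_def]; noncomm_ring
    · rw [map_sub, sigmaZero_mul p c s hc, sigmaZero_mul p c s hc, sub_mul,
        mul_assoc _ (sigmaZero p c s a), ha, mul_assoc _ (sigmaZero p c s b), hb, lie_def]
      noncomm_ring

/-- The central extension of `𝒟_p^±` by `ℂ C` given by the restriction of `Ψ`. -/
noncomputable def DpHat (p : ℂ[X]) (c : ℂ) (s : ℤˣ) (hc : IsSymmetricAbout p c) :
    LieSubalgebra ℂ DHat :=
  (DpSub p c s hc).comap proj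

/-- The principal gradation of the central extension of `𝒟_p^±`. -/
noncomputable def grading (p : ℂ[X]) (c : ℂ) (s : ℤˣ) (hc : IsSymmetricAbout p c) (k : ℤ) :
    Submodule ℂ (DpHat p c s hc) :=
  (hatGrade k).comap (DpHat p c s hc).toSubmodule.subtype

/-! ### Highest weight modules of a graded Lie algebra -/

section HighestWeight

variable {L : Type*} [LieRing L] [LieAlgebra ℂ L]

attribute [local instance] LieRing.ofAssociativeRing

/-- The left ideal generated by `L_j` for `j > 0` and by `h - lam(h)` for `h ∈ L_0`. -/
noncomputable def vermaIdeal (gr : ℤ → Submodule ℂ L) (lam : Module.Dual ℂ (gr 0)) :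
    Submodule (UniversalEnvelopingAlgebra ℂ L) (UniversalEnvelopingAlgebra ℂ L) :=
  Submodule.span (UniversalEnvelopingAlgebra ℂ L)
    ({u | ∃ j : ℤ, 0 < j ∧ ∃ x ∈ gr j, u = UniversalEnvelopingAlgebra.ι ℂ x} ∪
      {u | ∃ h : gr 0, u = UniversalEnvelopingAlgebra.ι ℂ (h : L) -
        algebraMap ℂ (UniversalEnvelopingAlgebra ℂ L) (lam h)})

/-- The Verma module `M(L, lam)`: the tensor product over `U(L_0 ⊕ L_+)` of `U(L)` with the
one-dimensional module given by `lam`, which is the quotient of `U(L)` by `vermaIdeal`. A module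
over `L` is here a module over `U(L)`. -/
abbrev Verma (gr : ℤ → Submodule ℂ L) (lam : Module.Dual ℂ (gr 0)) : Type _ :=
  UniversalEnvelopingAlgebra ℂ L ⧸ vermaIdeal gr lam

/-- The products `x₁ ⋯ xₙ` in `U(L)` of homogeneous elements of degrees adding up to the given
integer. -/
inductive IsMonomial (gr : ℤ → Submodule ℂ L) : ℤ → UniversalEnvelopingAlgebra ℂ L → Prop
  | one : IsMonomial gr 0 1
  | mul {i j : ℤ} {x : L} {u : UniversalEnvelopingAlgebra ℂ L} :
      x ∈ gr i → IsMonomial gr j u →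
        IsMonomial gr (i + j) (UniversalEnvelopingAlgebra.ι ℂ x * u)

/-- The component of degree `j` of `U(L)`. -/
noncomputable def envelopingGrade (gr : ℤ → Submodule ℂ L) (j : ℤ) :
    Submodule ℂ (UniversalEnvelopingAlgebra ℂ L) :=
  Submodule.span ℂ {u | IsMonomial gr j u}

/-- The component of degree `j` of the Verma module, whose highest weight vector has degree `0`. -/
noncomputable def vermaGrade (gr : ℤ → Submodule ℂ L) (lam : Module.Dual ℂ (gr 0)) (j : ℤ) :
    Submodule ℂ (Verma gr lam) :=
  (envelopingGrade gr j).map ((vermaIdeal gr lam).mkQ.restrictScalars ℂ)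

/-- A submodule `N` of the Verma module is graded if it is the sum of its homogeneous components
`N ∩ M_j`. -/
def IsGradedSubmodule (gr : ℤ → Submodule ℂ L) (lam : Module.Dual ℂ (gr 0))
    (N : Submodule (UniversalEnvelopingAlgebra ℂ L) (Verma gr lam)) : Prop :=
  N.restrictScalars ℂ = ⨆ j : ℤ, N.restrictScalars ℂ ⊓ vermaGrade gr lam j

/-- The maximal proper graded submodule of the Verma module, as the sum of all proper graded
submodules. -/
noncomputable def maxGradedSubmodule (gr : ℤ → Submodule ℂ L) (lam : Module.Dual ℂ (gr 0)) :
    Submodule (UniversalEnvelopingAlgebra ℂ L) (Verma gr lam) :=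
  sSup {N | IsGradedSubmodule gr lam N ∧ N ≠ ⊤}

/-- The irreducible highest weight module `L(L, lam)`. -/
abbrev Irred (gr : ℤ → Submodule ℂ L) (lam : Module.Dual ℂ (gr 0)) : Type _ :=
  Verma gr lam ⧸ maxGradedSubmodule gr lam

/-- The component of degree `j` of the irreducible highest weight module. -/
noncomputable def irredGrade (gr : ℤ → Submodule ℂ L) (lam : Module.Dual ℂ (gr 0)) (j : ℤ) :
    Submodule ℂ (Irred gr lam) :=
  (vermaGrade gr lam j).map ((maxGradedSubmodule gr lam).mkQ.restrictScalars ℂ)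

/-- All homogeneous components of the irreducible highest weight module are finite-dimensional. -/
def IsQuasifinite (gr : ℤ → Submodule ℂ L) (lam : Module.Dual ℂ (gr 0)) : Prop :=
  ∀ j : ℤ, FiniteDimensional ℂ (irredGrade gr lam j)

end HighestWeight

/-! ### Labels and generating series -/

/-- `(D - c/2) ^ l p(D)`, as an element of the central extension of `𝒟`. -/
noncomputable def labelOp (p : ℂ[X]) (c : ℂ) (l : ℕ) : DHat :=
  (mon 0 ((X - C (c / 2)) ^ l * p), 0)

theorem labelOp_mem (p : ℂ[X]) (c : ℂ) (s : ℤˣ) (hc : IsSymmetricAbout p c) (l : ℕ)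
    (hl : Odd (l + p.natDegree)) : labelOp p c l ∈ DpHat p c s hc := by
  refine ⟨mon 0 ((X - C (c / 2)) ^ l), ?_, ?_⟩
  · change mon 0 _ = _
    rw [mon_mul_mon]; simp
  · change _ = -mon 0 _
    have h : ((-X + C c : ℂ[X]) - C (c / 2)) = (-1) * (X - C (c / 2)) := by
      have : (C c : ℂ[X]) = C (c / 2) + C (c / 2) := by rw [← C_add, add_halves]
      rw [this]; ring
    rw [sigmaZero_mon, smul_mul_assoc, mon_mul_mon, ← map_smul, ← map_neg]
    congr 1
    simp only [Int.cast_zero, C_0, sub_zero, add_zero, comp_X, pow_comp, sub_comp, X_comp,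
      C_comp, h, zpow_zero, Units.val_one, Int.cast_one, mul_one, mul_pow, smul_eq_C_mul, C_pow,
      C_neg, C_1]
    rw [show ((-1 : ℂ[X]) ^ p.natDegree * ((-1) ^ l * (X - C (c / 2)) ^ l * p)) =
      (-1) ^ (l + p.natDegree) * ((X - C (c / 2)) ^ l * p) by ring, hl.neg_one_pow]
    ring

theorem labelOp_mem_grading (p : ℂ[X]) (c : ℂ) (s : ℤˣ) (hc : IsSymmetricAbout p c) (l : ℕ)
    (hl : Odd (l + p.natDegree)) :
    (⟨labelOp p c l, labelOp_mem p c s hc l hl⟩ : DpHat p c s hc) ∈ grading p c s hc 0 :=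
  ⟨⟨_, rfl⟩, fun h => absurd rfl h⟩

open Classical in
/-- The series `∑ Δ_l x ^ l / l!` over the `l ≥ 0` of parity opposite to that of `deg p`, where
`Δ_l = -lam((D - c/2) ^ l p(D))`. -/
noncomputable def labelSeries (p : ℂ[X]) (c : ℂ) (s : ℤˣ) (hc : IsSymmetricAbout p c)
    (lam : Module.Dual ℂ (grading p c s hc 0)) : PowerSeries ℂ :=
  PowerSeries.mk fun l =>
    if hl : Odd (l + p.natDegree) then
      -lam ⟨⟨labelOp p c l, labelOp_mem p c s hc l hl⟩, labelOp_mem_grading p c s hc l hl⟩ /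
        (l.factorial : ℂ)
    else 0

/-- The series of `exp(α x)`. -/
noncomputable def expSeries (α : ℂ) : PowerSeries ℂ :=
  PowerSeries.rescale α (PowerSeries.exp ℂ)

/-- Quasipolynomials: linear combinations of `q(x) exp(α x)` with `q` a polynomial. -/
def IsQuasipolynomial (φ : PowerSeries ℂ) : Prop :=
  φ ∈ Submodule.span ℂ
    {ψ : PowerSeries ℂ | ∃ (q : ℂ[X]) (α : ℂ), ψ = (q : PowerSeries ℂ) * expSeries α}

/-- `φ(-x) = φ(x)`. -/
def IsEvenSeries (φ : PowerSeries ℂ) : Prop :=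
  PowerSeries.rescale (-1 : ℂ) φ = φ

/-- The series of `2 sinh(x/2)`. -/
noncomputable def twoSinhHalf : PowerSeries ℂ :=
  expSeries (1 / 2) - expSeries (-(1 / 2))

/-- The operator `p(d/dx + c/2)` on power series. -/
noncomputable def shiftedOp (p : ℂ[X]) (c : ℂ) : Module.End ℂ (PowerSeries ℂ) :=
  aeval ((PowerSeries.derivative ℂ : PowerSeries ℂ →ₗ[ℂ] PowerSeries ℂ) +
    (c / 2) • (1 : Module.End ℂ (PowerSeries ℂ))) p

end CircleOp

namespace CircleOp

/-! ### Highest weight functionals on enveloping algebras -/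

section Enveloping

attribute [local instance] LieRing.ofAssociativeRing

variable {L : Type*} [LieRing L] [LieAlgebra ℂ L]

local notation "𝒰" => UniversalEnvelopingAlgebra ℂ
local notation "ι" => UniversalEnvelopingAlgebra.ι ℂ

/-! Every power series is `genSeries Γ`, that is Γ(exp(xX)), for a functional Γ on ℂ[X]. Under this
dictionary d/dx is multiplication by X inside Γ, and multiplication by exp(αx) is the shift X ↦ X +
α. A series is a quasipolynomial exactly when some nonzero B(d/dx) kills it, that is, when its
functional vanishes on the ideal (B).

Let Δ_λ = p(d/dx + c/2) g with g = `genSeries Γ`. Then λ takes the value -Γ(F(X + c/2)) on F(D) in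
degree 0, and on [t^k F(D), t^(-k) G(D)] it telescopes to the sum over 0 ≤ i < k of Θ(H(X + (c+1)/2
+ i)), where H = F(X - k) G (`map_lie_mon_mon`). Here Θ is `diffFunctional`, whose series is 2
sinh(x/2) g + λ(C) exp(-(c+1)x/2) (`genSeries_diffFunctional`). The central charge contributes only
an exponential, so Θ kills a nonzero ideal if and only if φ = 2 sinh(x/2) g is a quasipolynomial.

If Θ kills (B), the operators of degree -k whose coefficient is divisible by p and by k suitable
shifts of B form a family of finite codimension, stable under the nonnegative part, on whose
brackets into degree 0 the weight vanishes. They annihilate the highest weight vector v of the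
irreducible module, so finitely many letters in each negative degree generate it
(`isQuasifinite_of_diffFunctional`).

Conversely, if the component of degree -1 is finite-dimensional, a nonzero operator of degree -1
kills v, and its brackets with degree 1 give Θ(D q) = 0 for a fixed nonzero even D and all even q
(`exists_diffFunctional_eq_zero`). Choosing g odd makes φ even, and symmetrizing Θ under X ↦ -X
turns this into a differential equation for φ (`exists_quasipolynomial`).

Both directions detect the maximal graded submodule by the coefficient of v, a functional on U(L)
obtained from an explicit action on U(N), N the negative part, without the Poincaré–Birkhoff–Witt
theorem. -/

theorem ι_lie (x y : L) : ι ⁅x, y⁆ = ι x * ι y - ι y * ι x := by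
  rw [LieHom.map_lie, LieRing.of_associative_ring_bracket]

theorem ι_mul_ι (x y : L) : ι x * ι y = ι y * ι x + ι ⁅x, y⁆ := by
  rw [ι_lie]; abel

/-- A subspace of `U(L)` containing `1` and stable under left multiplication by `L` is `U(L)`. -/
theorem enveloping_eq_top (S : Submodule ℂ (𝒰 L)) (h1 : (1 : 𝒰 L) ∈ S)
    (hS : ∀ (x : L), ∀ u ∈ S, ι x * u ∈ S) : S = ⊤ := by
  let T : Subalgebra ℂ (𝒰 L) :=
    { carrier := {u | ∀ a ∈ S, u * a ∈ S}
      mul_mem' := fun {u w} hu hw a ha => by rw [mul_assoc]; exact hu _ (hw _ ha)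
      add_mem' := fun {u w} hu hw a ha => by rw [add_mul]; exact S.add_mem (hu _ ha) (hw _ ha)
      algebraMap_mem' := fun r a ha => by
        rw [← Algebra.smul_def]; exact S.smul_mem _ ha }
  let f : L →ₗ⁅ℂ⁆ T :=
    { toFun := fun x => ⟨ι x, fun a ha => hS x a ha⟩
      map_add' := fun x y => Subtype.ext (map_add (ι) x y)
      map_smul' := fun z x => Subtype.ext (map_smul (ι) z x)
      map_lie' := fun {x y} => Subtype.ext (by
        rw [LieRing.of_associative_ring_bracket]; exact ι_lie x y) }
  have key : T.val.comp (UniversalEnvelopingAlgebra.lift ℂ f) = AlgHom.id ℂ (𝒰 L) := by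
    apply UniversalEnvelopingAlgebra.hom_ext
    ext x
    change ((UniversalEnvelopingAlgebra.lift ℂ f (ι x) : T) : 𝒰 L) = ι x
    rw [UniversalEnvelopingAlgebra.lift_ι_apply]
    rfl
  rw [eq_top_iff]
  intro u _
  have : u = ((UniversalEnvelopingAlgebra.lift ℂ f u : T) : 𝒰 L) :=
    (DFunLike.congr_fun key u).symm
  rw [this, ← mul_one ((UniversalEnvelopingAlgebra.lift ℂ f u : T) : 𝒰 L)]
  exact (UniversalEnvelopingAlgebra.lift ℂ f u).2 1 h1

/-- Left induction in an enveloping algebra. -/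
theorem enveloping_induction {P : 𝒰 L → Prop} (u : 𝒰 L) (h1 : P 1)
    (hadd : ∀ a b, P a → P b → P (a + b)) (hsmul : ∀ (z : ℂ) a, P a → P (z • a))
    (hmul : ∀ x a, P a → P (ι x * a)) : P u := by
  let S : Submodule ℂ (𝒰 L) :=
    { carrier := {u | P u}
      add_mem' := fun {a b} ha hb => hadd a b ha hb
      zero_mem' := by simpa using hsmul 0 1 h1
      smul_mem' := fun z a ha => hsmul z a ha }
  have : S = ⊤ := enveloping_eq_top S h1 hmul
  exact (this ▸ Submodule.mem_top : u ∈ S)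

/-! ### The induced module realised on U(N). -/

section Induced

variable (N : LieSubalgebra ℂ L)

/-- The action of `N` on linear maps from `L` to `U(N)`. -/
noncomputable def homAction : N →ₗ⁅ℂ⁆ Module.End ℂ (L →ₗ[ℂ] 𝒰 N) where
  -- If R_a denotes the map x ↦ x·a, a module structure with N acting by left multiplication must
  -- satisfy R_{na} = n R_a - R_a ∘ ad n. Read as an action of N on Hom(L, U(N)), this rule extends
  -- to U(N) by the universal property and so defines R_a for every a from R_1.
  toFun n :=
    { toFun := fun r => LinearMap.mulLeft ℂ (ι n) ∘ₗ r - r ∘ₗ (LieAlgebra.ad ℂ L (n : L))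
      map_add' := fun r r' => by ext x; simp [mul_add]; abel
      map_smul' := fun z r => by ext x; simp [smul_sub] }
  map_add' n n' := by ext r x; simp [add_mul]; abel
  map_smul' z n := by ext r x; simp [smul_sub]
  map_lie' := by
    intro n n'
    rw [LieRing.of_associative_ring_bracket]
    ext r x
    change ι ⁅n, n'⁆ * r x - r ⁅⁅(n : L), (n' : L)⁆, x⁆ =
      (ι n * (ι n' * r x - r ⁅(n' : L), x⁆) -
        (ι n' * r ⁅(n : L), x⁆ - r ⁅(n' : L), ⁅(n : L), x⁆⁆)) -
      (ι n' * (ι n * r x - r ⁅(n : L), x⁆) - (ι n * r ⁅(n' : L), x⁆ - r ⁅(n : L), ⁅(n' : L), x⁆⁆))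
    rw [ι_lie, lie_lie, map_sub]
    noncomm_ring

variable {N} (pr : L →ₗ[ℂ] N) (χ : L →ₗ[ℂ] ℂ)

/-- The action of `x` in `L` on the highest weight vector of the induced module `U(N)`. -/
noncomputable def inducedBase : L →ₗ[ℂ] 𝒰 N :=
  (ι : N →ₗ⁅ℂ⁆ 𝒰 N).toLinearMap ∘ₗ pr + (Algebra.linearMap ℂ (𝒰 N)) ∘ₗ χ

theorem inducedBase_apply (x : L) :
    inducedBase pr χ x = ι (pr x) + algebraMap ℂ (𝒰 N) (χ x) := rfl

/-- The action of `L` on the induced module `U(N)`, with the vector as first argument. -/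
noncomputable def inducedAct : 𝒰 N →ₗ[ℂ] L →ₗ[ℂ] 𝒰 N :=
  LinearMap.applyₗ (inducedBase pr χ) ∘ₗ
    (UniversalEnvelopingAlgebra.lift ℂ (homAction N)).toLinearMap

theorem inducedAct_one (x : L) : inducedAct pr χ 1 x = inducedBase pr χ x := by
  simp [inducedAct]

theorem inducedAct_ι_mul (n : N) (a : 𝒰 N) (x : L) :
    inducedAct pr χ (ι n * a) x = ι n * inducedAct pr χ a x - inducedAct pr χ a ⁅(n : L), x⁆ := by
  simp only [inducedAct, LinearMap.comp_apply, AlgHom.toLinearMap_apply, map_mul,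
    UniversalEnvelopingAlgebra.lift_ι_apply]
  rfl

theorem inducedAct_algebraMap (z : ℂ) (x : L) :
    inducedAct pr χ (algebraMap ℂ (𝒰 N) z) x = z • inducedBase pr χ x := by
  rw [Algebra.algebraMap_eq_smul_one, map_smul, LinearMap.smul_apply, inducedAct_one]

variable {pr χ} (hpr : ∀ n : N, pr n = n) (hχ : ∀ n : N, χ n = 0)

include hpr hχ in
theorem inducedAct_coe (n : N) (a : 𝒰 N) : inducedAct pr χ a n = ι n * a := by
  induction a using enveloping_induction generalizing n with
  | h1 => rw [inducedAct_one, inducedBase_apply, hpr, hχ]; simp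
  | hadd a b ha hb => rw [map_add, LinearMap.add_apply, ha, hb, mul_add]
  | hsmul z a ha => rw [map_smul, LinearMap.smul_apply, ha, mul_smul_comm]
  | hmul m a ha =>
    have : ⁅(m : L), (n : L)⁆ = ((⁅m, n⁆ : N) : L) := rfl
    rw [inducedAct_ι_mul, this, ha, ha, ι_lie]
    noncomm_ring

variable (hker : ∀ x y, pr x = 0 → pr y = 0 → pr ⁅x, y⁆ = 0 ∧ χ ⁅x, y⁆ = 0)

include hpr hχ hker in
-- By `hker`, the kernel of `pr` is a subalgebra on which χ is a character. This is needed only for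
-- the vector 1; passing from a to n a is the Jacobi identity.
theorem inducedAct_lie (x y : L) (a : 𝒰 N) :
    inducedAct pr χ a ⁅x, y⁆ = inducedAct pr χ (inducedAct pr χ a y) x -
      inducedAct pr χ (inducedAct pr χ a x) y := by
  induction a using enveloping_induction generalizing x y with
  | h1 =>
    -- Split x and y into their parts in N and in the kernel of `pr`; the bracket of the two kernel
    -- parts acts by zero on 1.
    have hz (z : L) : pr (z - pr z) = 0 := by rw [map_sub, hpr, sub_self]
    obtain ⟨h1, h2⟩ := hker _ _ (hz x) (hz y)
    have h3 : inducedBase pr χ ⁅x - pr x, y - pr y⁆ = 0 := by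
      rw [inducedBase_apply, h1, h2]; simp
    have h4 : inducedBase pr χ ⁅(pr x : L), (pr y : L)⁆ =
        ι (pr x) * ι (pr y) - ι (pr y) * ι (pr x) := by
      have : ⁅(pr x : L), (pr y : L)⁆ = ((⁅pr x, pr y⁆ : N) : L) := rfl
      rw [this, inducedBase_apply, hpr, hχ, ι_lie, map_zero, add_zero]
    have h5 : ⁅x - pr x, y - pr y⁆ = ⁅x, y⁆ + ⁅(pr y : L), x⁆ - ⁅(pr x : L), y⁆
        + ⁅(pr x : L), (pr y : L)⁆ := by
      rw [sub_lie, lie_sub, lie_sub, ← lie_skew x (pr y : L)]; abel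
    rw [h5, map_add, map_sub, map_add, h4] at h3
    simp only [inducedAct_one]
    rw [inducedBase_apply pr χ x, inducedBase_apply pr χ y]
    simp only [map_add, LinearMap.add_apply, inducedAct_algebraMap]
    rw [← mul_one (ι (pr x)), ← mul_one (ι (pr y)), inducedAct_ι_mul, inducedAct_ι_mul]
    simp only [inducedAct_one]
    have h6 : inducedBase pr χ ⁅x, y⁆ = inducedBase pr χ ⁅(pr x : L), y⁆
      - inducedBase pr χ ⁅(pr y : L), x⁆ - (ι (pr x) * ι (pr y) - ι (pr y) * ι (pr x)) := by
      rw [← sub_eq_zero, ← h3]; abel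
    rw [h6, inducedBase_apply pr χ x, inducedBase_apply pr χ y]
    simp only [mul_add, smul_add, Algebra.algebraMap_eq_smul_one, mul_smul_comm, mul_one,
      smul_smul, mul_comm (χ x) (χ y)]
    abel
  | hadd a b ha hb =>
    simp only [map_add, LinearMap.add_apply, ha, hb]; abel
  | hsmul z a ha => simp only [map_smul, LinearMap.smul_apply, ha, smul_sub]
  | hmul n a ha =>
    have h1 := ha ⁅(n : L), x⁆ y
    have h2 := ha x ⁅(n : L), y⁆
    have h3 := ha x y
    simp only [inducedAct_ι_mul, map_sub, LinearMap.sub_apply]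
    rw [leibniz_lie, map_add, h1, h2, h3, mul_sub]
    abel

/-- The induced module `U(N)` as a Lie algebra homomorphism. -/
noncomputable def inducedHom : L →ₗ⁅ℂ⁆ Module.End ℂ (𝒰 N) where
  __ := (inducedAct pr χ).flip
  map_lie' := by
    intro x y
    rw [LieRing.of_associative_ring_bracket]
    ext a
    exact inducedAct_lie hpr hχ hker x y a

include hpr hχ hker in
/-- The highest weight functional of the induced module. -/
theorem exists_highestWeight_functional : ∃ E : 𝒰 L →ₗ[ℂ] ℂ, E 1 = 1 ∧
    (∀ (n : N) u, E (ι (n : L) * u) = 0) ∧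
    ∀ x u, pr x = 0 → E (u * (ι x - algebraMap ℂ (𝒰 L) (χ x))) = 0 := by
  let Φ : 𝒰 L →ₐ[ℂ] Module.End ℂ (𝒰 N) :=
    UniversalEnvelopingAlgebra.lift ℂ (inducedHom hpr hχ hker)
  -- The augmentation of U(N) reads off the coefficient of the highest weight vector 1.
  let ε : 𝒰 N →ₐ[ℂ] ℂ := UniversalEnvelopingAlgebra.lift ℂ (0 : N →ₗ⁅ℂ⁆ ℂ)
  have hΦ (x : L) (a) : Φ (ι x) a = inducedAct pr χ a x := by
    simp only [Φ, UniversalEnvelopingAlgebra.lift_ι_apply]; rfl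
  refine ⟨ε.toLinearMap ∘ₗ LinearMap.applyₗ (1 : 𝒰 N) ∘ₗ Φ.toLinearMap, ?_, ?_, ?_⟩
  · simp
  · intro n u
    have h : Φ (ι (n : L) * u) 1 = ι n * Φ u 1 := by
      rw [map_mul, Module.End.mul_apply, hΦ, inducedAct_coe hpr hχ]
    have : ε (ι n) = 0 := by
      simp only [ε, UniversalEnvelopingAlgebra.lift_ι_apply]; rfl
    change ε (Φ (ι (n : L) * u) 1) = 0
    rw [h, map_mul, this, zero_mul]
  · intro x u hx
    have h : Φ (ι x - algebraMap ℂ (𝒰 L) (χ x)) 1 = 0 := by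
      rw [map_sub, LinearMap.sub_apply, hΦ, inducedAct_one, inducedBase_apply, hx, AlgHom.commutes]
      simp [Algebra.algebraMap_eq_smul_one]
    change ε (Φ (u * (ι x - algebraMap ℂ (𝒰 L) (χ x))) 1) = 0
    rw [map_mul, Module.End.mul_apply, h, map_zero, map_zero]

end Induced
end Enveloping
/-! ### Highest weight modules of graded Lie algebras -/

section Graded

attribute [local instance] LieRing.ofAssociativeRing

variable {L : Type*} [LieRing L] [LieAlgebra ℂ L]

local notation "𝒰" => UniversalEnvelopingAlgebra ℂ
local notation "ι" => UniversalEnvelopingAlgebra.ι ℂ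

/-! ### Spanning by words in letters of negative degree. -/

section Words

variable {M : Type*} [AddCommGroup M] [Module (𝒰 L) M] [Module ℂ M] [IsScalarTower ℂ (𝒰 L) M]

/-- The vectors `x₁ ⋯ xₙ v` with `xᵢ ∈ Q dᵢ`, all `dᵢ` negative with the given sum. -/
inductive IsWord (Q : ℤ → Submodule ℂ L) (v : M) : ℤ → M → Prop
  | base : IsWord Q v 0 v
  | mul {i j : ℤ} {x : L} {m : M} : i < 0 → x ∈ Q i → IsWord Q v j m → IsWord Q v (i + j) (ι x • m)

/-- The span of the words of a given degree. -/
def wordSpan (Q : ℤ → Submodule ℂ L) (v : M) (j : ℤ) : Submodule ℂ M :=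
  Submodule.span ℂ {m | IsWord Q v j m}

omit [Module ℂ M] [IsScalarTower ℂ (𝒰 L) M] in
theorem smul_smul_swap (x y : L) (m : M) : ι x • ι y • m = ι y • ι x • m + ι ⁅x, y⁆ • m := by
  rw [smul_smul, ι_mul_ι, add_smul, mul_smul]

theorem ι_smul_complex_smul (x : L) (z : ℂ) (m : M) : ι x • z • m = z • ι x • m := by
  rw [← algebraMap_smul (𝒰 L) z m, smul_smul, ← Algebra.commutes, mul_smul, algebraMap_smul]

omit [Module ℂ M] [IsScalarTower ℂ (𝒰 L) M] in
theorem add_ι_smul (x y : L) (m : M) : ι (x + y) • m = ι x • m + ι y • m := by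
  rw [map_add, add_smul]

theorem smul_ι_smul (z : ℂ) (x : L) (m : M) : ι (z • x) • m = z • ι x • m := by
  rw [map_smul, smul_assoc]

/-- The action of `L` on a `U(L)`-module as a bilinear map. -/
noncomputable def lieAct : L →ₗ[ℂ] M →ₗ[ℂ] M :=
  LinearMap.mk₂ ℂ (fun x m => ι x • m) add_ι_smul smul_ι_smul
    (fun _ m m' => smul_add _ m m') (fun z x m => ι_smul_complex_smul x z m)

variable {Q gr : ℤ → Submodule ℂ L} {v : M}

omit [Module ℂ M] [IsScalarTower ℂ (𝒰 L) M] in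
theorem IsWord.degree_le {j : ℤ} {m : M} (h : IsWord Q v j m) : j ≤ 0 := by
  induction h with
  | base => rfl
  | mul hi _ _ ih => omega

theorem ι_smul_mem_wordSpan {i j : ℤ} {x : L} {m : M} (hi : i < 0) (hx : x ∈ Q i)
    (hm : m ∈ wordSpan Q v j) : ι x • m ∈ wordSpan Q v (i + j) := by
  have : wordSpan Q v j ≤ (wordSpan Q v (i + j)).comap (lieAct x) :=
    Submodule.span_le.2 fun m hm => Submodule.subset_span (IsWord.mul hi hx hm)
  exact this hm

/-- Move x past the first letter y: both x and [x, y] then act on a shorter word. At the end of the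
recursion `hv` rewrites x v using letters from Q only. -/
theorem smul_isWord_mem_wordSpan
    (hgr : ∀ {i j : ℤ} {x y : L}, x ∈ gr i → y ∈ gr j → ⁅x, y⁆ ∈ gr (i + j))
    (hQ : ∀ i, Q i ≤ gr i) (hv : ∀ i, ∀ x ∈ gr i, ι x • v ∈ wordSpan Q v i)
    {j : ℤ} {m : M} (hm : IsWord Q v j m) {i : ℤ} {x : L} (hx : x ∈ gr i) :
    ι x • m ∈ wordSpan Q v (i + j) := by
  induction hm generalizing i x with
  | base => rw [add_zero]; exact hv i x hx
  | @mul k l y m hk hy _ ih =>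
    rw [smul_smul_swap]
    refine Submodule.add_mem _ ?_ ?_
    · rw [show i + (k + l) = k + (i + l) by ring]
      exact ι_smul_mem_wordSpan hk hy (ih hx)
    · rw [← add_assoc]
      exact ih (hgr hx (hQ k hy))

theorem smul_mem_wordSpan
    (hgr : ∀ {i j : ℤ} {x y : L}, x ∈ gr i → y ∈ gr j → ⁅x, y⁆ ∈ gr (i + j))
    (hQ : ∀ i, Q i ≤ gr i) (hv : ∀ i, ∀ x ∈ gr i, ι x • v ∈ wordSpan Q v i)
    {j : ℤ} {u : 𝒰 L} (hu : u ∈ envelopingGrade gr j) : u • v ∈ wordSpan Q v j := by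
  have key : envelopingGrade gr j ≤
      (wordSpan Q v j).comap (LinearMap.toSpanSingleton (𝒰 L) M v |>.restrictScalars ℂ) := by
    refine Submodule.span_le.2 fun a ha => ?_
    change a • v ∈ wordSpan Q v j
    clear hu
    induction ha with
    | one => rw [one_smul]; exact Submodule.subset_span IsWord.base
    | @mul i j x u hx _ ih =>
      rw [mul_smul]
      have : wordSpan Q v j ≤ (wordSpan Q v (i + j)).comap (lieAct x) :=
        Submodule.span_le.2 fun m hm => smul_isWord_mem_wordSpan hgr hQ hv hm hx
      exact this ih
  exact key hu

/-- Since letters have strictly negative degree, a nonempty word of degree -n is a letter of degree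
-(n - d) applied to a word of degree -d with 0 ≤ d < n, which leaves finitely many
finite-dimensional contributions. -/
theorem finiteDimensional_wordSpan (hQ : ∀ i < 0, FiniteDimensional ℂ (Q i)) (j : ℤ) :
    FiniteDimensional ℂ (wordSpan Q v j) := by
  have key : ∀ n : ℕ, (wordSpan Q v (-(n : ℤ))).FG := by
    intro n
    induction n using Nat.strong_induction_on with
    | _ n ih =>
      let B : Submodule ℂ M := Submodule.span ℂ {v} ⊔ ⨆ d : Fin n,
        Submodule.map₂ lieAct (Q (-(n - d : ℤ))) (wordSpan Q v (-((d : ℕ) : ℤ)))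
      have hB : B.FG := by
        refine (Submodule.fg_span_singleton v).sup (Submodule.fg_iSup _ fun d => ?_)
        have hd := d.2
        have := hQ (-(n - d : ℤ)) (by omega)
        exact Submodule.FG.map₂ _ ((Submodule.fg_iff_finiteDimensional _).2 this) (ih d hd)
      have hle : wordSpan Q v (-(n : ℤ)) ≤ B := by
        refine Submodule.span_le.2 fun m (hm : IsWord Q v (-(n : ℤ)) m) => ?_
        generalize hk : -(n : ℤ) = k at hm
        cases hm with
        | base => exact Submodule.mem_sup_left (Submodule.mem_span_singleton_self v)
        | @mul i j x m hi hx hm =>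
          have hj := hm.degree_le
          obtain ⟨d, rfl⟩ : ∃ d : ℕ, j = -(d : ℤ) := ⟨(-j).toNat, by omega⟩
          refine Submodule.mem_sup_right (Submodule.mem_iSup_of_mem ⟨d, by omega⟩ ?_)
          refine Submodule.apply_mem_map₂ (m := x) (n := m) lieAct ?_ (Submodule.subset_span hm)
          rwa [show -((n : ℤ) - ((d : ℕ) : ℤ)) = i by omega]
      have := (Submodule.fg_iff_finiteDimensional _).1 hB
      exact (Submodule.fg_iff_finiteDimensional _).2 (Submodule.finiteDimensional_of_le hle)
  rcases le_or_gt j 0 with hj | hj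
  · obtain ⟨n, rfl⟩ : ∃ n : ℕ, j = -(n : ℤ) := ⟨(-j).toNat, by omega⟩
    exact (Submodule.fg_iff_finiteDimensional _).1 (key n)
  · have : wordSpan Q v j = ⊥ := by
      refine Submodule.span_eq_bot.2 fun m hm => ?_
      have := IsWord.degree_le hm
      omega
    rw [this]
    infer_instance

end Words

theorem IsMonomial.mul_mem {gr : ℤ → Submodule ℂ L} {i j : ℤ} {u w : 𝒰 L} (hu : IsMonomial gr i u)
    (hw : IsMonomial gr j w) : IsMonomial gr (i + j) (u * w) := by
  induction hu with
  | one => rwa [zero_add, one_mul]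
  | mul hx _ ih => rw [mul_assoc, add_assoc]; exact IsMonomial.mul hx ih

theorem mul_mem_envelopingGrade {gr : ℤ → Submodule ℂ L} {i j : ℤ} {u w : 𝒰 L}
    (hu : u ∈ envelopingGrade gr i) (hw : w ∈ envelopingGrade gr j) :
    u * w ∈ envelopingGrade gr (i + j) := by
  have : envelopingGrade gr i * envelopingGrade gr j ≤ envelopingGrade gr (i + j) := by
    rw [envelopingGrade, envelopingGrade, Submodule.span_mul_span]
    refine Submodule.span_le.2 ?_
    rintro _ ⟨a, ha, b, hb, rfl⟩
    exact Submodule.subset_span (IsMonomial.mul_mem ha hb)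
  exact this (Submodule.mul_mem_mul hu hw)

theorem ι_mem_envelopingGrade {gr : ℤ → Submodule ℂ L} {i : ℤ} {x : L} (hx : x ∈ gr i) :
    ι x ∈ envelopingGrade gr i := by
  have := IsMonomial.mul hx (IsMonomial.one (gr := gr))
  rw [mul_one, add_zero] at this
  exact Submodule.subset_span this

theorem iSup_envelopingGrade {gr : ℤ → Submodule ℂ L} (htop : ⨆ i, gr i = ⊤) :
    ⨆ i, envelopingGrade gr i = ⊤ := by
  refine enveloping_eq_top _ ?_ fun x u hu => ?_
  · exact Submodule.mem_iSup_of_mem 0 (Submodule.subset_span IsMonomial.one)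
  · have hx : x ∈ ⨆ i, gr i := htop ▸ Submodule.mem_top
    induction hx using Submodule.iSup_induction' with
    | zero => simp
    | add x y _ _ hx hy => rw [map_add, add_mul]; exact Submodule.add_mem _ hx hy
    | mem i x hx =>
      induction hu using Submodule.iSup_induction' with
      | zero => simp
      | add a b _ _ ha hb => rw [mul_add]; exact Submodule.add_mem _ ha hb
      | mem j u hu =>
        exact Submodule.mem_iSup_of_mem (i + j)
          (mul_mem_envelopingGrade (ι_mem_envelopingGrade hx) hu)

end Graded
-- Verma modules and their maximal graded submodules.
section Verma

attribute [local instance] LieRing.ofAssociativeRing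

variable {L : Type*} [LieRing L] [LieAlgebra ℂ L]

local notation "𝒰" => UniversalEnvelopingAlgebra ℂ
local notation "ι" => UniversalEnvelopingAlgebra.ι ℂ

/-- `gr` is a gradation of `L` and `E` is the coefficient of the highest weight vector in the Verma
module of highest weight `lam`, as a functional on `U(L)`. -/
structure IsHighestWeightFunctional (gr : ℤ → Submodule ℂ L) (lam : Module.Dual ℂ (gr 0))
    (E : 𝒰 L →ₗ[ℂ] ℂ) : Prop where
  lie_mem : ∀ {i j : ℤ} {x y : L}, x ∈ gr i → y ∈ gr j → ⁅x, y⁆ ∈ gr (i + j)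
  iSup_eq_top : ⨆ i, gr i = ⊤
  map_one : E 1 = 1
  map_neg_mul : ∀ j < 0, ∀ x ∈ gr j, ∀ u, E (ι x * u) = 0
  map_mul_pos : ∀ j > 0, ∀ x ∈ gr j, ∀ u, E (u * ι x) = 0
  map_mul_zero : ∀ (h : gr 0) (u), E (u * (ι (h : L) - algebraMap ℂ (𝒰 L) (lam h))) = 0

/-- The highest weight vector. -/
noncomputable def vermaVec (gr : ℤ → Submodule ℂ L) (lam : Module.Dual ℂ (gr 0)) : Verma gr lam :=
  Submodule.Quotient.mk 1

variable {gr : ℤ → Submodule ℂ L} {lam : Module.Dual ℂ (gr 0)} {E : 𝒰 L →ₗ[ℂ] ℂ}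

theorem mk_eq_smul_vermaVec (u : 𝒰 L) :
    (Submodule.Quotient.mk u : Verma gr lam) = u • vermaVec gr lam := by
  rw [vermaVec, ← Submodule.Quotient.mk_smul, smul_eq_mul, mul_one]

theorem exists_smul_vermaVec (m : Verma gr lam) : ∃ u : 𝒰 L, m = u • vermaVec gr lam := by
  obtain ⟨u, rfl⟩ := Submodule.Quotient.mk_surjective _ m
  exact ⟨u, mk_eq_smul_vermaVec u⟩

theorem pos_smul_vermaVec {j : ℤ} (hj : 0 < j) {x : L} (hx : x ∈ gr j) :
    ι x • vermaVec gr lam = 0 := by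
  rw [← mk_eq_smul_vermaVec, Submodule.Quotient.mk_eq_zero]
  exact Submodule.subset_span (Or.inl ⟨j, hj, x, hx, rfl⟩)

theorem zero_smul_vermaVec (h : gr 0) :
    ι (h : L) • vermaVec gr lam = lam h • vermaVec gr lam := by
  have : (Submodule.Quotient.mk (ι (h : L) - algebraMap ℂ (𝒰 L) (lam h)) : Verma gr lam) = 0 := by
    rw [Submodule.Quotient.mk_eq_zero]
    exact Submodule.subset_span (Or.inr ⟨h, rfl⟩)
  rw [mk_eq_smul_vermaVec, sub_smul, algebraMap_smul, sub_eq_zero] at this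
  exact this

namespace IsHighestWeightFunctional

variable (hE : IsHighestWeightFunctional gr lam E)

include hE in
theorem map_vermaIdeal {u : 𝒰 L} (hu : u ∈ vermaIdeal gr lam) : E u = 0 := by
  -- The ideal is a left ideal, so the induction has to carry an arbitrary left factor w.
  have key : ∀ w, E (w * u) = 0 := by
    induction hu using Submodule.span_induction with
    | mem u hu =>
      rintro w
      rcases hu with ⟨j, hj, x, hx, rfl⟩ | ⟨h, rfl⟩
      · exact hE.map_mul_pos j hj x hx w
      · exact hE.map_mul_zero h w
    | zero => simp
    | add a b _ _ ha hb => intro w; rw [mul_add, map_add, ha, hb, add_zero]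
    | smul a u _ hu => intro w; rw [smul_eq_mul, ← mul_assoc, hu]
  simpa using key 1

/-- The coefficient of the highest weight vector in a vector of the Verma module. -/
noncomputable def coeff : Verma gr lam →ₗ[ℂ] ℂ :=
  ((vermaIdeal gr lam).restrictScalars ℂ).liftQ E (fun _ hu => hE.map_vermaIdeal hu) ∘ₗ
    (Submodule.Quotient.restrictScalarsEquiv ℂ (vermaIdeal gr lam)).symm.toLinearMap

theorem coeff_smul_vermaVec (u : 𝒰 L) : hE.coeff (u • vermaVec gr lam) = E u := by
  rw [← mk_eq_smul_vermaVec]; rfl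

theorem coeff_vermaVec : hE.coeff (vermaVec gr lam) = 1 := by
  rw [← one_smul (𝒰 L) (vermaVec gr lam), coeff_smul_vermaVec, hE.map_one]

theorem coeff_neg_smul {j : ℤ} (hj : j < 0) {x : L} (hx : x ∈ gr j) (m : Verma gr lam) :
    hE.coeff (ι x • m) = 0 := by
  obtain ⟨u, rfl⟩ := exists_smul_vermaVec m
  rw [smul_smul, coeff_smul_vermaVec, hE.map_neg_mul j hj x hx]

include hE in
-- The nonnegative part acts on the highest weight vector by scalars, so only negative letters
-- remain; in degree 0 this leaves the line of that vector.
theorem vermaGrade_le_wordSpan (j : ℤ) :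
    vermaGrade gr lam j ≤ wordSpan gr (vermaVec gr lam) j := by
  rintro _ ⟨u, hu, rfl⟩
  change (Submodule.Quotient.mk u : Verma gr lam) ∈ _
  rw [mk_eq_smul_vermaVec]
  refine smul_mem_wordSpan (Q := gr) (gr := gr) hE.lie_mem (fun _ => le_rfl) (fun i x hx => ?_) hu
  have hbase : vermaVec gr lam ∈ wordSpan gr (vermaVec gr lam) 0 :=
    Submodule.subset_span IsWord.base
  rcases lt_trichotomy i 0 with hi | rfl | hi
  · simpa using ι_smul_mem_wordSpan hi hx hbase
  · rw [zero_smul_vermaVec ⟨x, hx⟩]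
    exact Submodule.smul_mem _ _ hbase
  · rw [pos_smul_vermaVec hi hx]
    exact Submodule.zero_mem _

theorem coeff_vermaGrade {j : ℤ} (hj : j ≠ 0) {m : Verma gr lam} (hm : m ∈ vermaGrade gr lam j) :
    hE.coeff m = 0 := by
  have : wordSpan gr (vermaVec gr lam) j ≤ LinearMap.ker hE.coeff := by
    refine Submodule.span_le.2 fun m (hm : IsWord gr _ j m) => ?_
    cases hm with
    | base => exact absurd rfl hj
    | mul hi hx _ => exact hE.coeff_neg_smul hi hx _
  exact this (hE.vermaGrade_le_wordSpan j hm)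

theorem vermaGrade_zero {m : Verma gr lam} (hm : m ∈ vermaGrade gr lam 0) :
    m = hE.coeff m • vermaVec gr lam := by
  have : wordSpan gr (vermaVec gr lam) 0 ≤ Submodule.span ℂ {vermaVec gr lam} := by
    refine Submodule.span_le.2 fun m (hm : IsWord gr _ 0 m) => ?_
    generalize hj : (0 : ℤ) = j at hm
    cases hm with
    | base => exact Submodule.mem_span_singleton_self _
    | mul hi _ h => have := h.degree_le; omega
  obtain ⟨z, rfl⟩ := Submodule.mem_span_singleton.1 (this (hE.vermaGrade_le_wordSpan 0 hm))
  rw [map_smul, hE.coeff_vermaVec, smul_eq_mul, mul_one]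

/-- A proper graded submodule meets degree 0 in zero, since degree 0 is spanned by the generator of
the whole module. So it lies in the submodule K of vectors all of whose U(L)-multiples have
coefficient 0, and hence so does the sum of all of them. -/
theorem coeff_of_mem_maxGradedSubmodule {m : Verma gr lam} (hm : m ∈ maxGradedSubmodule gr lam) :
    hE.coeff m = 0 := by
  let K : Submodule (𝒰 L) (Verma gr lam) :=
    { carrier := {m | ∀ u : 𝒰 L, hE.coeff (u • m) = 0}
      add_mem' := fun {a b} ha hb u => by rw [smul_add, map_add, ha, hb, add_zero]
      zero_mem' := fun u => by rw [smul_zero, map_zero]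
      smul_mem' := fun u m hm w => by rw [smul_smul]; exact hm _ }
  have hK : maxGradedSubmodule gr lam ≤ K := by
    refine sSup_le ?_
    rintro N ⟨hN, hNtop⟩ m hm u
    have key : N.restrictScalars ℂ ≤ LinearMap.ker hE.coeff := by
      rw [hN]
      refine iSup_le fun j => ?_
      rintro m ⟨hmN, hmj⟩
      by_cases hj : j = 0
      · subst hj
        by_contra hz
        have hz' : hE.coeff m ≠ 0 := hz
        refine hNtop ?_
        have hv : vermaVec gr lam ∈ N.restrictScalars ℂ := by
          have h1 := Submodule.smul_mem (N.restrictScalars ℂ) (hE.coeff m)⁻¹ hmN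
          rwa [hE.vermaGrade_zero hmj, map_smul, hE.coeff_vermaVec, smul_eq_mul, mul_one, smul_smul,
            inv_mul_cancel₀ hz', one_smul] at h1
        rw [eq_top_iff]
        intro w _
        obtain ⟨u, rfl⟩ := exists_smul_vermaVec w
        exact N.smul_mem u hv
      · exact hE.coeff_vermaGrade hj hmj
    exact key (N.smul_mem u hm)
  simpa using hK hm 1

/-- The submodule generated by w is graded because w is homogeneous, and proper because it contains
only vectors of coefficient 0. -/
theorem mem_maxGradedSubmodule {k : ℤ} {w : Verma gr lam} (hw : w ∈ vermaGrade gr lam k)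
    (h : ∀ u : 𝒰 L, hE.coeff (u • w) = 0) : w ∈ maxGradedSubmodule gr lam := by
  let N : Submodule (𝒰 L) (Verma gr lam) := Submodule.span (𝒰 L) {w}
  have hN : N ≤ maxGradedSubmodule gr lam := by
    refine le_sSup ⟨?_, fun htop => ?_⟩
    · refine le_antisymm ?_ (iSup_le fun j => inf_le_left)
      intro m hm
      obtain ⟨u, rfl⟩ := Submodule.mem_span_singleton.1 (show m ∈ N from hm)
      clear hm
      have hu : u ∈ ⨆ i, envelopingGrade gr i :=
        (iSup_envelopingGrade hE.iSup_eq_top) ▸ Submodule.mem_top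
      induction hu using Submodule.iSup_induction' with
      | zero => simp
      | add a b _ _ ha hb => rw [add_smul]; exact Submodule.add_mem _ ha hb
      | mem i u hu =>
        refine Submodule.mem_iSup_of_mem (i + k) ⟨?_, ?_⟩
        · exact N.smul_mem u (Submodule.mem_span_singleton_self w)
        · obtain ⟨a, ha, rfl⟩ := hw
          exact ⟨u * a, mul_mem_envelopingGrade hu ha, rfl⟩
    · have hv : vermaVec gr lam ∈ N := htop ▸ Submodule.mem_top
      obtain ⟨u, hu⟩ := Submodule.mem_span_singleton.1 hv
      have h1 := h u
      rw [hu, hE.coeff_vermaVec] at h1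
      exact one_ne_zero h1
  exact hN (Submodule.mem_span_singleton_self w)

theorem ι_smul_vermaVec_mem {k : ℤ} {x : L} (hx : x ∈ gr k) :
    ι x • vermaVec gr lam ∈ vermaGrade gr lam k := by
  rw [← mk_eq_smul_vermaVec]
  exact ⟨ι x, ι_mem_envelopingGrade hx, rfl⟩

include hE in
/-- A family of subspaces of the negative part that is stable under the nonnegative part, and on
which the highest weight vanishes, annihilates the highest weight vector of the irreducible
module. -/
theorem ι_smul_vermaVec_mem_max {P : ℤ → Submodule ℂ L} (hP : ∀ k, P k ≤ gr k)
    (hlie : ∀ j k, 0 ≤ j → j + k < 0 → ∀ y ∈ gr j, ∀ x ∈ P k, ⁅y, x⁆ ∈ P (j + k))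
    (hlam : ∀ j k, 0 < j → j + k = 0 → ∀ y ∈ gr j, ∀ x ∈ P k, ∀ h : ⁅y, x⁆ ∈ gr 0,
      lam ⟨⁅y, x⁆, h⟩ = 0)
    {k : ℤ} (hk : k < 0) {x : L} (hx : x ∈ P k) :
    ι x • vermaVec gr lam ∈ maxGradedSubmodule gr lam := by
  -- Z is the smallest subspace containing all x v with x in P and stable under the negative part.
  -- Minimality replaces induction on its elements.
  let Z : Submodule ℂ (Verma gr lam) :=
    sInf {N | (∀ k < 0, ∀ x ∈ P k, ι x • vermaVec gr lam ∈ N) ∧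
      ∀ j < 0, ∀ y ∈ gr j, ∀ m ∈ N, ι y • m ∈ N}
  have hZP : ∀ k < 0, ∀ x ∈ P k, ι x • vermaVec gr lam ∈ Z := fun k hk x hx => by
    rw [Submodule.mem_sInf]
    exact fun N hN => hN.1 k hk x hx
  have hZn : ∀ j < 0, ∀ y ∈ gr j, ∀ m ∈ Z, ι y • m ∈ Z := fun j hj y hy m hm => by
    rw [Submodule.mem_sInf] at hm ⊢
    exact fun N hN => hN.2 j hj y hy m (hm N hN)
  -- The vectors of Z that every homogeneous element sends back into Z. This subspace has the two
  -- defining properties of Z, so it equals Z, and Z is stable under all of L.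
  let Z' : Submodule ℂ (Verma gr lam) :=
    { carrier := {m | m ∈ Z ∧ ∀ i, ∀ y ∈ gr i, ι y • m ∈ Z}
      add_mem' := fun {a b} ha hb => ⟨Z.add_mem ha.1 hb.1, fun i y hy => by
        rw [smul_add]; exact Z.add_mem (ha.2 i y hy) (hb.2 i y hy)⟩
      zero_mem' := ⟨Z.zero_mem, fun i y hy => by rw [smul_zero]; exact Z.zero_mem⟩
      smul_mem' := fun z m hm => ⟨Z.smul_mem z hm.1, fun i y hy => by
        rw [ι_smul_complex_smul]; exact Z.smul_mem z (hm.2 i y hy)⟩ }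
  have hZ' : Z ≤ Z' := by
    refine sInf_le ⟨fun k hk x hx => ⟨hZP k hk x hx, fun i y hy => ?_⟩,
      fun j hj f hf m hm => ⟨hZn j hj f hf m hm.1, fun i y hy => ?_⟩⟩
    · rcases lt_or_ge i 0 with hi | hi
      · exact hZn i hi y hy _ (hZP k hk x hx)
      · rw [smul_smul_swap]
        refine Z.add_mem ?_ ?_
        · rcases hi.eq_or_lt with rfl | hi
          · rw [zero_smul_vermaVec ⟨y, hy⟩, ι_smul_complex_smul]
            exact Z.smul_mem _ (hZP k hk x hx)
          · rw [pos_smul_vermaVec hi hy, smul_zero]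
            exact Z.zero_mem
        · have hg := hE.lie_mem hy (hP k hx)
          rcases lt_trichotomy (i + k) 0 with h | h | h
          · exact hZP _ h _ (hlie i k hi h y hy x hx)
          · rw [h] at hg
            have h0 := zero_smul_vermaVec (lam := lam) ⟨⁅y, x⁆, hg⟩
            rw [hlam i k (by omega) h y hy x hx hg, zero_smul] at h0
            rw [show ι ⁅y, x⁆ • vermaVec gr lam = 0 from h0]
            exact Z.zero_mem
          · rw [pos_smul_vermaVec h hg]
            exact Z.zero_mem
    · rw [smul_smul_swap]
      exact Z.add_mem (hZn j hj f hf _ (hm.2 i y hy)) (hm.2 _ _ (hE.lie_mem hy hf))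
  have hZL : ∀ (y : L), ∀ m ∈ Z, ι y • m ∈ Z := fun y m hm => by
    have hy : y ∈ ⨆ i, gr i := hE.iSup_eq_top ▸ Submodule.mem_top
    induction hy using Submodule.iSup_induction' with
    | zero => rw [map_zero, zero_smul]; exact Z.zero_mem
    | add a b _ _ ha hb => rw [map_add, add_smul]; exact Z.add_mem ha hb
    | mem i y hy => exact (hZ' hm).2 i y hy
  -- Both generating operations of Z end by applying an element of negative degree, which produces
  -- coefficient 0.
  have hZE : Z ≤ LinearMap.ker hE.coeff := by
    refine sInf_le ⟨fun k hk x hx => hE.coeff_neg_smul hk (hP k hx) _,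
      fun j hj y hy m _ => hE.coeff_neg_smul hj hy m⟩
  refine hE.mem_maxGradedSubmodule (ι_smul_vermaVec_mem (hP k hx)) fun u => hZE ?_
  induction u using enveloping_induction with
  | h1 => rw [one_smul]; exact hZP k hk x hx
  | hadd a b ha hb => rw [add_smul]; exact Z.add_mem ha hb
  | hsmul z a ha => rw [smul_assoc]; exact Z.smul_mem z ha
  | hmul y a ha => rw [mul_smul]; exact hZL y _ ha

include hE in
-- In the irreducible module x v depends only on x modulo P, so the words with letters in the
-- finite-dimensional spaces Q span it.
theorem isQuasifinite {P : ℤ → Submodule ℂ L} (hP : ∀ k, P k ≤ gr k)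
    (hlie : ∀ j k, 0 ≤ j → j + k < 0 → ∀ y ∈ gr j, ∀ x ∈ P k, ⁅y, x⁆ ∈ P (j + k))
    (hlam : ∀ j k, 0 < j → j + k = 0 → ∀ y ∈ gr j, ∀ x ∈ P k, ∀ h : ⁅y, x⁆ ∈ gr 0,
      lam ⟨⁅y, x⁆, h⟩ = 0)
    (hfin : ∀ k < 0, ∃ Q ≤ gr k, FiniteDimensional ℂ Q ∧ gr k ≤ Q ⊔ P k) :
    IsQuasifinite gr lam := by
  choose! Q hQ1 hQ2 hQ3 using hfin
  -- The chosen Q is controlled only in negative degrees; zero elsewhere keeps Q' inside the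
  -- gradation.
  let Q' : ℤ → Submodule ℂ L := fun k => if k < 0 then Q k else ⊥
  let v : Irred gr lam := Submodule.Quotient.mk (vermaVec gr lam)
  have hι (x : L) : ι x • v = Submodule.Quotient.mk (ι x • vermaVec gr lam) := rfl
  have hbase : v ∈ wordSpan Q' v 0 := Submodule.subset_span IsWord.base
  have hv : ∀ i, ∀ x ∈ gr i, ι x • v ∈ wordSpan Q' v i := by
    intro i x hx
    rcases lt_trichotomy i 0 with hi | rfl | hi
    · obtain ⟨q, hq, p, hp, rfl⟩ := Submodule.mem_sup.1 (hQ3 i hi hx)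
      have h0 : ι p • v = 0 := by
        rw [hι, Submodule.Quotient.mk_eq_zero]
        exact hE.ι_smul_vermaVec_mem_max hP hlie hlam hi hp
      rw [add_ι_smul, h0, add_zero]
      have := ι_smul_mem_wordSpan (Q := Q') (x := q) hi (by simp only [Q', if_pos hi, hq]) hbase
      rwa [add_zero] at this
    · have h0 : ι x • v = lam ⟨x, hx⟩ • v := by
        rw [hι, zero_smul_vermaVec ⟨x, hx⟩]
        rfl
      rw [h0]
      exact Submodule.smul_mem _ _ hbase
    · rw [hι, pos_smul_vermaVec hi hx, Submodule.Quotient.mk_zero]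
      exact Submodule.zero_mem _
  have hQ' : ∀ i, Q' i ≤ gr i := fun i => by
    by_cases hi : i < 0
    · simp only [Q', if_pos hi]; exact hQ1 i hi
    · simp only [Q', if_neg hi]; exact bot_le
  intro j
  have hle : irredGrade gr lam j ≤ wordSpan Q' v j := by
    rintro _ ⟨_, ⟨u, hu, rfl⟩, rfl⟩
    have : u • v ∈ wordSpan Q' v j := smul_mem_wordSpan hE.lie_mem hQ' hv hu
    have h2 : u • v = Submodule.Quotient.mk (u • vermaVec gr lam) := rfl
    rw [h2, ← mk_eq_smul_vermaVec] at this
    exact this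
  have : FiniteDimensional ℂ (wordSpan Q' v j) := finiteDimensional_wordSpan (fun i hi => by
    have h : Q' i = Q i := if_pos hi
    rw [h]; exact hQ2 i hi) j
  exact Submodule.finiteDimensional_of_le hle

include hE in
-- The map a ↦ F(a) v from an infinite-dimensional space to a finite-dimensional component has a
-- nonzero kernel element. Applying y of degree k gives y F(a) v = λ([y, F(a)]) v in the Verma
-- module; this vector lies in the maximal graded submodule, so its coefficient is 0.
theorem exists_lam_lie_eq_zero (hq : IsQuasifinite gr lam) {k : ℤ} (hk : 0 < k) {V : Type*}
    [AddCommGroup V] [Module ℂ V] (hV : ¬ FiniteDimensional ℂ V) (F : V →ₗ[ℂ] L)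
    (hF : ∀ a, F a ∈ gr (-k)) : ∃ a ≠ 0, ∀ y ∈ gr k, ∀ h : ⁅y, F a⁆ ∈ gr 0,
      lam ⟨⁅y, F a⁆, h⟩ = 0 := by
  have hfin := hq (-k)
  let T : V →ₗ[ℂ] irredGrade gr lam (-k) := LinearMap.codRestrict _
    ((maxGradedSubmodule gr lam).mkQ.restrictScalars ℂ ∘ₗ
      LinearMap.flip lieAct (vermaVec gr lam) ∘ₗ F)
    (fun a => ⟨_, ι_smul_vermaVec_mem (hF a), rfl⟩)
  have hT : ¬ Function.Injective T := fun hinj => hV (FiniteDimensional.of_injective T hinj)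
  rw [← LinearMap.ker_eq_bot, Submodule.eq_bot_iff] at hT
  push Not at hT
  obtain ⟨a, ha, ha0⟩ := hT
  refine ⟨a, ha0, fun y hy h => ?_⟩
  have hmem : ι (F a) • vermaVec gr lam ∈ maxGradedSubmodule gr lam := by
    have h1 : (maxGradedSubmodule gr lam).mkQ (ι (F a) • vermaVec gr lam) = 0 :=
      congrArg Subtype.val (LinearMap.mem_ker.1 ha)
    rwa [Submodule.mkQ_apply, Submodule.Quotient.mk_eq_zero] at h1
  have h2 := hE.coeff_of_mem_maxGradedSubmodule ((maxGradedSubmodule gr lam).smul_mem (ι y) hmem)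
  rwa [smul_smul_swap, pos_smul_vermaVec hk hy, smul_zero, zero_add,
    zero_smul_vermaVec ⟨⁅y, F a⁆, h⟩, map_smul, hE.coeff_vermaVec, smul_eq_mul, mul_one] at h2

end IsHighestWeightFunctional

end Verma
/-! ### The highest weight functional of the central extension -/

/-- The coefficient `f k` of the operator `∑ k, t ^ k (f k)(D)`. -/
noncomputable def coef (k : ℤ) : DiffOp →ₗ[ℂ] ℂ[X] := Finsupp.lapply k

theorem coef_mon (k j : ℤ) (f : ℂ[X]) : coef k (mon j f) = if j = k then f else 0 :=
  Finsupp.single_apply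

theorem coef_mon_same (k : ℤ) (f : ℂ[X]) : coef k (mon k f) = f := by
  rw [coef_mon, if_pos rfl]

theorem eq_sum_mon (a : DiffOp) : ∃ S : Finset ℤ, a = ∑ k ∈ S, mon k (coef k a) :=
  ⟨Finsupp.support a, (Finsupp.sum_single a).symm⟩

theorem coef_mul_mon_zero (a : DiffOp) (p : ℂ[X]) (k : ℤ) :
    coef k (a * mon 0 p) = coef k a * p := by
  induction a using induction_mon with
  | h0 => simp
  | hadd a b ha hb => rw [add_mul, map_add, map_add, ha, hb, add_mul]
  | hmon j f =>
    rw [mon_mul_mon, coef_mon, coef_mon, add_zero]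
    split_ifs <;> simp

theorem coef_sigmaZero (p : ℂ[X]) (c : ℂ) (s : ℤˣ) (a : DiffOp) (k : ℤ) :
    coef k (sigmaZero p c s a) = ((-1) ^ p.natDegree * (((s ^ k : ℤˣ) : ℤ) : ℂ)) •
      (coef k a).comp (-X - C (k : ℂ) + C c) := by
  induction a using induction_mon with
  | h0 => simp
  | hadd a b ha hb => rw [map_add, map_add, map_add, ha, hb, add_comp, smul_add]
  | hmon j f =>
    rw [sigmaZero_mon, map_smul, coef_mon, coef_mon]
    by_cases h : j = k
    · subst h; simp
    · simp [h]

theorem mon_mem_DpSub {p : ℂ[X]} {c : ℂ} {s : ℤˣ} (hc : IsSymmetricAbout p c) {k : ℤ} {f : ℂ[X]}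
    (hf : ((-1) ^ p.natDegree * (((s ^ k : ℤˣ) : ℤ) : ℂ)) • f.comp (-X - C (k : ℂ) + C c) = -f) :
    mon k (f * p) ∈ DpSub p c s hc := by
  refine ⟨mon k f, ?_, ?_⟩
  · rw [mon_mul_mon]; simp
  · rw [sigmaZero_mon, ← map_smul, hf, mon_mul_mon, ← map_neg]; simp

/-- Cancelling the nonzero factor p turns the condition on a p(D) into one on each coefficient of a,
so the subalgebra is a graded subspace. -/
theorem exists_coef_of_mem_DpSub {p : ℂ[X]} (hp : p ≠ 0) {c : ℂ} {s : ℤˣ}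
    {hc : IsSymmetricAbout p c} {d : DiffOp} (hd : d ∈ DpSub p c s hc) (k : ℤ) :
    ∃ f : ℂ[X], coef k d = f * p ∧
      ((-1) ^ p.natDegree * (((s ^ k : ℤˣ) : ℤ) : ℂ)) • f.comp (-X - C (k : ℂ) + C c) = -f := by
  obtain ⟨a, rfl, ha⟩ := hd
  refine ⟨coef k a, coef_mul_mon_zero a p k, mul_right_cancel₀ hp ?_⟩
  have := congrArg (coef k) ha
  rwa [coef_mul_mon_zero, coef_sigmaZero, map_neg, coef_mul_mon_zero, ← neg_mul] at this

theorem mon_coef_mem_DpSub {p : ℂ[X]} (hp : p ≠ 0) {c : ℂ} {s : ℤˣ}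
    {hc : IsSymmetricAbout p c} {d : DiffOp} (hd : d ∈ DpSub p c s hc) (k : ℤ) :
    mon k (coef k d) ∈ DpSub p c s hc := by
  obtain ⟨f, h1, h2⟩ := exists_coef_of_mem_DpSub hp hd k
  rw [h1]
  exact mon_mem_DpSub hc h2

/-- The inclusion of `𝒟` as a subspace of its central extension. -/
noncomputable def incl : DiffOp →ₗ[ℂ] DHat := LinearMap.inl ℂ DiffOp ℂ

/-- The inclusion of the central line. -/
noncomputable def central : ℂ →ₗ[ℂ] DHat := LinearMap.inr ℂ DiffOp ℂ

/-- The coefficient of the central element. -/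
noncomputable def centralCoef : DHat →ₗ[ℂ] ℂ := LinearMap.snd ℂ DiffOp ℂ

theorem eq_incl_add_central (x : DHat) : x = incl x.1 + central x.2 :=
  (Prod.fst_add_snd x).symm

theorem incl_mon_mem (k : ℤ) (f : ℂ[X]) : incl (mon k f) ∈ hatGrade k := ⟨⟨f, rfl⟩, fun _ => rfl⟩

theorem central_mem (z : ℂ) : central z ∈ hatGrade 0 :=
  ⟨⟨0, by rw [map_zero]; rfl⟩, fun h => absurd rfl h⟩

theorem exists_of_mem_hatGrade {k : ℤ} {x : DHat} (hx : x ∈ hatGrade k) :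
    ∃ f : ℂ[X], ∃ z : ℂ, (k ≠ 0 → z = 0) ∧ x = (mon k f, z) := by
  obtain ⟨⟨f, hf⟩, hz⟩ := hx
  exact ⟨f, x.2, hz, Prod.ext hf rfl⟩

theorem hatGrade_lie_mem {i j : ℤ} {x y : DHat} (hx : x ∈ hatGrade i) (hy : y ∈ hatGrade j) :
    ⁅x, y⁆ ∈ hatGrade (i + j) := by
  obtain ⟨⟨f, hf⟩, -⟩ := hx
  obtain ⟨⟨g, hg⟩, -⟩ := hy
  refine ⟨⟨f.comp (X + C (j : ℂ)) * g - g.comp (X + C (i : ℂ)) * f, ?_⟩, fun h => ?_⟩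
  · rw [DHat.lie_def, hf, hg, lie_def, mon_mul_mon, mon_mul_mon, map_sub, add_comm j i]
  · rw [DHat.lie_def, hf, hg]
    exact (psi_mon i j f g).trans (if_neg h)

/-- Because degree 0 is abelian, any linear functional on it is a character, hence a possible
highest weight. -/
theorem hatGrade_zero_lie {x y : DHat} (hx : x ∈ hatGrade 0) (hy : y ∈ hatGrade 0) :
    ⁅x, y⁆ = 0 := by
  obtain ⟨⟨f, hf⟩, -⟩ := hx
  obtain ⟨⟨g, hg⟩, -⟩ := hy
  rw [DHat.lie_def, hf, hg, lie_def, mon_mul_mon, mon_mul_mon, psi_mon]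
  simp [mul_comm]
  rfl

/-- The negative part of the central extension. -/
noncomputable def negPart : LieSubalgebra ℂ DHat where
  toSubmodule := ⨆ k : {k : ℤ // k < 0}, hatGrade k
  lie_mem' := by
    intro x y hx hy
    change x ∈ ⨆ k : {k : ℤ // k < 0}, hatGrade k at hx
    change y ∈ ⨆ k : {k : ℤ // k < 0}, hatGrade k at hy
    change ⁅x, y⁆ ∈ ⨆ k : {k : ℤ // k < 0}, hatGrade k
    induction hx using Submodule.iSup_induction' with
    | zero => simp
    | add a b _ _ ha hb => rw [add_lie]; exact Submodule.add_mem _ ha hb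
    | mem i x hx =>
      induction hy using Submodule.iSup_induction' with
      | zero => simp
      | add a b _ _ ha hb => rw [lie_add]; exact Submodule.add_mem _ ha hb
      | mem j y hy =>
        exact Submodule.mem_iSup_of_mem ⟨i + j, by have := i.2; have := j.2; omega⟩
          (hatGrade_lie_mem hx hy)

theorem mem_negPart {k : ℤ} (hk : k < 0) {x : DHat} (hx : x ∈ hatGrade k) : x ∈ negPart :=
  Submodule.mem_iSup_of_mem (p := fun k : {k : ℤ // k < 0} => hatGrade k) ⟨k, hk⟩ hx

/-- The projection onto the negative part, as an endomorphism. -/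
noncomputable def negProjAux : DHat →ₗ[ℂ] DHat :=
  incl ∘ₗ lift (fun k => if k < 0 then mon k else 0) ∘ₗ proj.toLinearMap

theorem negProjAux_of_neg {k : ℤ} (hk : k < 0) {x : DHat} (hx : x ∈ hatGrade k) :
    negProjAux x = x := by
  obtain ⟨f, z, hz, rfl⟩ := exists_of_mem_hatGrade hx
  rw [hz hk.ne]
  change incl (lift _ (mon k f)) = _
  rw [lift_mon, if_pos hk]
  rfl

theorem negProjAux_of_nonneg {k : ℤ} (hk : 0 ≤ k) {x : DHat} (hx : x ∈ hatGrade k) :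
    negProjAux x = 0 := by
  obtain ⟨f, z, hz, rfl⟩ := exists_of_mem_hatGrade hx
  change incl (lift _ (mon k f)) = _
  rw [lift_mon, if_neg hk.not_gt, LinearMap.zero_apply, map_zero]

theorem negProjAux_mem (x : DHat) : negProjAux x ∈ negPart := by
  change incl (lift _ x.1) ∈ negPart
  induction x.1 using induction_mon with
  | h0 => rw [map_zero, map_zero]; exact negPart.zero_mem
  | hadd a b ha hb => rw [map_add, map_add]; exact negPart.add_mem ha hb
  | hmon k f =>
    rw [lift_mon]
    split_ifs with hk
    · exact mem_negPart hk (incl_mon_mem k f)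
    · rw [LinearMap.zero_apply, map_zero]; exact negPart.zero_mem

theorem negProjAux_coe {x : DHat} (hx : x ∈ negPart) : negProjAux x = x := by
  change x ∈ ⨆ k : {k : ℤ // k < 0}, hatGrade k at hx
  induction hx using Submodule.iSup_induction' with
  | zero => simp
  | add a b _ _ ha hb => rw [map_add, ha, hb]
  | mem k x hx => exact negProjAux_of_neg k.2 hx

/-- The projection onto the negative part. -/
noncomputable def negProj : DHat →ₗ[ℂ] negPart :=
  negProjAux.codRestrict negPart.toSubmodule negProjAux_mem

theorem negProj_of_nonneg {k : ℤ} (hk : 0 ≤ k) {x : DHat} (hx : x ∈ hatGrade k) :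
    negProj x = 0 :=
  Subtype.ext (negProjAux_of_nonneg hk hx)

theorem mem_nonneg_of_negProj {x : DHat} (hx : negProj x = 0) :
    x ∈ ⨆ k : {k : ℤ // 0 ≤ k}, hatGrade k := by
  have key : x - negProjAux x ∈ ⨆ k : {k : ℤ // 0 ≤ k}, hatGrade k := by
    rw [eq_incl_add_central x]
    generalize x.1 = a
    generalize x.2 = z
    have h0 : negProjAux (central z) = 0 := negProjAux_of_nonneg le_rfl (central_mem z)
    rw [map_add, h0, add_zero, add_sub_right_comm]
    refine Submodule.add_mem _ ?_ (Submodule.mem_iSup_of_mem ⟨0, le_rfl⟩ (central_mem z))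
    induction a using induction_mon with
    | h0 => simp
    | hadd a b ha hb =>
      rw [map_add, map_add, add_sub_add_comm]; exact Submodule.add_mem _ ha hb
    | hmon k f =>
      rcases lt_or_ge k 0 with hk | hk
      · rw [negProjAux_of_neg hk (incl_mon_mem k f), sub_self]; exact Submodule.zero_mem _
      · rw [negProjAux_of_nonneg hk (incl_mon_mem k f), sub_zero]
        exact Submodule.mem_iSup_of_mem ⟨k, hk⟩ (incl_mon_mem k f)
  have h : negProjAux x = 0 := congrArg Subtype.val hx
  rwa [h, sub_zero] at key

/-- The projection onto the component of degree `0`. -/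
noncomputable def zeroProj : DHat →ₗ[ℂ] DHat :=
  incl ∘ₗ mon 0 ∘ₗ coef 0 ∘ₗ proj.toLinearMap + central ∘ₗ centralCoef

theorem zeroProj_of_mem {x : DHat} (hx : x ∈ hatGrade 0) : zeroProj x = x := by
  obtain ⟨⟨f, hf⟩, -⟩ := hx
  have h : zeroProj x = incl (mon 0 (coef 0 x.1)) + central x.2 := rfl
  rw [h, hf, coef_mon_same, ← hf, ← eq_incl_add_central]

theorem zeroProj_of_ne {k : ℤ} (hk : k ≠ 0) {x : DHat} (hx : x ∈ hatGrade k) : zeroProj x = 0 := by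
  obtain ⟨f, z, hz, rfl⟩ := exists_of_mem_hatGrade hx
  change incl (mon 0 (coef 0 (mon k f))) + central z = _
  rw [coef_mon, if_neg hk, hz hk, map_zero, map_zero, map_zero, add_zero]

/-! ### Gradation and highest weight functional of the subalgebra. -/

section

attribute [local instance] LieRing.ofAssociativeRing

variable {p : ℂ[X]} (hp : p ≠ 0) {c : ℂ} (hc : IsSymmetricAbout p c) (s : ℤˣ)

theorem grading_lie_mem {i j : ℤ} {x y : DpHat p c s hc} (hx : x ∈ grading p c s hc i)
    (hy : y ∈ grading p c s hc j) : ⁅x, y⁆ ∈ grading p c s hc (i + j) :=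
  hatGrade_lie_mem hx hy

include hp in
theorem iSup_grading : ⨆ k, grading p c s hc k = ⊤ := by
  rw [eq_top_iff]
  rintro ⟨x, hx⟩ -
  have hx' : x.1 ∈ DpSub p c s hc := hx
  obtain ⟨S, hS⟩ := eq_sum_mon x.1
  let y : ℤ → DpHat p c s hc := fun k => ⟨incl (mon k (coef k x.1)), mon_coef_mem_DpSub hp hx' k⟩
  let w : DpHat p c s hc := ⟨central x.2, (DpSub p c s hc).zero_mem⟩
  have h : (⟨x, hx⟩ : DpHat p c s hc) = ∑ k ∈ S, y k + w := by
    refine Subtype.ext ?_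
    change x = (DpHat p c s hc).toSubmodule.subtype (∑ k ∈ S, y k + w)
    rw [map_add, map_sum]
    change x = ∑ k ∈ S, incl (mon k (coef k x.1)) + central x.2
    rw [← map_sum, ← hS]
    exact eq_incl_add_central x
  rw [h]
  refine Submodule.add_mem _ (Submodule.sum_mem _ fun k _ => ?_) ?_
  · exact Submodule.mem_iSup_of_mem k (incl_mon_mem k _)
  · exact Submodule.mem_iSup_of_mem 0 (central_mem _)

/-- Any linear extension serves: it is again a highest weight by `hatGrade_zero_lie`, and it can be
evaluated on operators without checking membership in the subalgebra. -/
theorem exists_extension (lam : Module.Dual ℂ (grading p c s hc 0)) :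
    ∃ μ : DHat →ₗ[ℂ] ℂ, ∀ h : grading p c s hc 0, μ (h : DpHat p c s hc) = lam h := by
  let i : grading p c s hc 0 →ₗ[ℂ] DHat :=
    (DpHat p c s hc).toSubmodule.subtype ∘ₗ (grading p c s hc 0).subtype
  have hi : Function.Injective i := Subtype.val_injective.comp Subtype.val_injective
  obtain ⟨g, hg⟩ := LinearMap.exists_leftInverse_of_injective i (LinearMap.ker_eq_bot.2 hi)
  exact ⟨lam ∘ₗ g, fun h => congrArg lam (DFunLike.congr_fun hg h)⟩

include hp in
-- The functional is built on U of the full central extension, where the projection onto the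
-- negative part is explicit, and then pulled back along the inclusion of the subalgebra.
theorem exists_isHighestWeightFunctional (lam : Module.Dual ℂ (grading p c s hc 0)) :
    ∃ E, IsHighestWeightFunctional (grading p c s hc) lam E := by
  obtain ⟨μ, hμ⟩ := exists_extension hc s lam
  have hχ {k : ℤ} (hk : k ≠ 0) {x : DHat} (hx : x ∈ hatGrade k) : (μ ∘ₗ zeroProj) x = 0 := by
    rw [LinearMap.comp_apply, zeroProj_of_ne hk hx, map_zero]
  obtain ⟨E, h1, h2, h3⟩ := exists_highestWeight_functional (L := DHat) (N := negPart)
    (pr := negProj) (χ := μ ∘ₗ zeroProj) (fun n => Subtype.ext (negProjAux_coe n.2))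
    (by
      rintro ⟨n, hn⟩
      change n ∈ ⨆ k : {k : ℤ // k < 0}, hatGrade k at hn
      change (μ ∘ₗ zeroProj) n = 0
      induction hn using Submodule.iSup_induction' with
      | zero => rw [map_zero]
      | add a b _ _ ha hb => rw [map_add, ha, hb, add_zero]
      | mem k x hx => exact hχ k.2.ne hx)
    (by
      intro x y hx hy
      have hx' := mem_nonneg_of_negProj hx
      have hy' := mem_nonneg_of_negProj hy
      clear hx hy
      induction hx' using Submodule.iSup_induction' with
      | zero => rw [zero_lie, map_zero, map_zero]; exact ⟨rfl, rfl⟩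
      | add a b _ _ ha hb =>
        rw [add_lie, map_add, map_add, ha.1, ha.2, hb.1, hb.2, add_zero, add_zero]; exact ⟨rfl, rfl⟩
      | mem i x hx =>
        induction hy' using Submodule.iSup_induction' with
        | zero => rw [lie_zero, map_zero, map_zero]; exact ⟨rfl, rfl⟩
        | add a b _ _ ha hb =>
          rw [lie_add, map_add, map_add, ha.1, ha.2, hb.1, hb.2, add_zero, add_zero]
          exact ⟨rfl, rfl⟩
        | mem j y hy =>
          obtain ⟨i, hi⟩ := i
          obtain ⟨j, hj⟩ := j
          have hxy := hatGrade_lie_mem hx hy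
          refine ⟨negProj_of_nonneg (add_nonneg hi hj) hxy, ?_⟩
          by_cases h : i + j = 0
          · obtain ⟨rfl, rfl⟩ : i = 0 ∧ j = 0 := by omega
            rw [hatGrade_zero_lie hx hy, map_zero]
          · exact hχ h hxy)
  -- The homomorphism of enveloping algebras induced by the inclusion; its injectivity plays no
  -- role.
  let Φ := UniversalEnvelopingAlgebra.lift ℂ
    ((UniversalEnvelopingAlgebra.ι ℂ : DHat →ₗ⁅ℂ⁆ _).comp (DpHat p c s hc).incl)
  have hΦ (x : DpHat p c s hc) : Φ (UniversalEnvelopingAlgebra.ι ℂ x) =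
      UniversalEnvelopingAlgebra.ι ℂ (x : DHat) := by
    simp only [Φ, UniversalEnvelopingAlgebra.lift_ι_apply]
    rfl
  refine ⟨E ∘ₗ Φ.toLinearMap, ?_⟩
  constructor
  · exact fun hx hy => grading_lie_mem hc s hx hy
  · exact iSup_grading hp hc s
  · simpa using h1
  · intro j hj x hx u
    change E (Φ _) = 0
    rw [map_mul, hΦ]
    exact h2 ⟨x, mem_negPart hj hx⟩ _
  · intro j hj x hx u
    change E (Φ _) = 0
    have := h3 x (Φ u) (negProj_of_nonneg hj.le hx)
    have hx0 : (μ ∘ₗ zeroProj) (x : DHat) = 0 := hχ hj.ne' hx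
    rw [hx0, map_zero, sub_zero] at this
    rw [map_mul, hΦ, this]
  · intro h u
    change E (Φ _) = 0
    have := h3 (h : DpHat p c s hc) (Φ u) (negProj_of_nonneg le_rfl h.2)
    have hh : (μ ∘ₗ zeroProj) ((h : DpHat p c s hc) : DHat) = lam h := by
      rw [← hμ]
      exact congrArg μ (zeroProj_of_mem (x := ((h : DpHat p c s hc) : DHat)) h.2)
    rw [hh] at this
    rw [map_mul, map_sub, hΦ, AlgHom.commutes, this]

end

/-! ### Generating series of functionals and quasipolynomials -/

/-- The formal derivative as an endomorphism. -/
noncomputable def ddx : Module.End ℂ (PowerSeries ℂ) :=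
  (PowerSeries.derivative ℂ : PowerSeries ℂ →ₗ[ℂ] PowerSeries ℂ)

theorem ddx_apply (ψ : PowerSeries ℂ) : ddx ψ = PowerSeries.derivative ℂ ψ := rfl

theorem shiftedOp_eq (p : ℂ[X]) (c : ℂ) :
    shiftedOp p c = aeval ddx (p.comp (X + C (c / 2))) := by
  rw [aeval_comp, shiftedOp]
  congr 2
  rw [map_add, aeval_X, aeval_C, Algebra.algebraMap_eq_smul_one]
  rfl

/-- The series `∑ Γ(X ^ l) x ^ l / l!`, that is `Γ(exp(x X))`. -/
noncomputable def genSeries : (ℂ[X] →ₗ[ℂ] ℂ) →ₗ[ℂ] PowerSeries ℂ where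
  toFun Γ := PowerSeries.mk fun l => Γ (X ^ l) / (l.factorial : ℂ)
  map_add' Γ Γ' := by ext l; simp [add_div]
  map_smul' z Γ := by ext l; simp [mul_div_assoc]

theorem coeff_genSeries (Γ : ℂ[X] →ₗ[ℂ] ℂ) (l : ℕ) :
    PowerSeries.coeff l (genSeries Γ) = Γ (X ^ l) / (l.factorial : ℂ) :=
  PowerSeries.coeff_mk l fun l => Γ (X ^ l) / (l.factorial : ℂ)

theorem aeval_ddx_mul (q r : ℂ[X]) (ψ : PowerSeries ℂ) :
    aeval ddx (q * r) ψ = aeval ddx q (aeval ddx r ψ) := by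
  rw [map_mul]; rfl

theorem factorial_ne_zero' (l : ℕ) : (l.factorial : ℂ) ≠ 0 :=
  Nat.cast_ne_zero.2 l.factorial_ne_zero

theorem genSeries_surjective (ψ : PowerSeries ℂ) : ∃ Γ, genSeries Γ = ψ := by
  refine ⟨(basisMonomials ℂ).constr ℂ fun l => (l.factorial : ℂ) * PowerSeries.coeff l ψ, ?_⟩
  ext l
  have h := (basisMonomials ℂ).constr_basis ℂ
    (fun l => (l.factorial : ℂ) * PowerSeries.coeff l ψ) l
  simp only [coe_basisMonomials, monomial_one_right_eq_X_pow] at h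
  rw [coeff_genSeries, h]
  exact mul_div_cancel_left₀ _ (factorial_ne_zero' l)

theorem ddx_genSeries (Γ : ℂ[X] →ₗ[ℂ] ℂ) :
    ddx (genSeries Γ) = genSeries (Γ ∘ₗ LinearMap.mulLeft ℂ X) := by
  ext l
  rw [ddx_apply, PowerSeries.coeff_derivative, coeff_genSeries, coeff_genSeries,
    LinearMap.comp_apply, LinearMap.mulLeft_apply, ← pow_succ', Nat.factorial_succ]
  have := factorial_ne_zero' l
  have : (l : ℂ) + 1 ≠ 0 := Nat.cast_add_one_ne_zero l
  push_cast
  field_simp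

/-- Differentiating exp(xX) in x brings down a factor X. -/
theorem aeval_ddx_genSeries (q : ℂ[X]) (Γ : ℂ[X] →ₗ[ℂ] ℂ) :
    aeval ddx q (genSeries Γ) = genSeries (Γ ∘ₗ LinearMap.mulLeft ℂ q) := by
  induction q using Polynomial.induction_on' generalizing Γ with
  | add q r hq hr =>
    rw [map_add, LinearMap.add_apply, hq, hr, ← map_add]
    congr 1
    ext l
    simp [add_mul]
  | monomial n z =>
    induction n generalizing Γ with
    | zero =>
      rw [monomial_zero_left, aeval_C, Module.algebraMap_end_apply, ← map_smul]
      congr 1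
      ext l
      simp [← smul_eq_C_mul]
    | succ n ih =>
      rw [← monomial_mul_X, map_mul, Module.End.mul_apply, aeval_X, ddx_genSeries, ih]
      congr 1
      refine LinearMap.ext fun r => ?_
      simp only [LinearMap.comp_apply, LinearMap.mulLeft_apply]
      congr 1
      ring

theorem coeff_expSeries (α : ℂ) (l : ℕ) :
    PowerSeries.coeff l (expSeries α) = α ^ l / (l.factorial : ℂ) := by
  rw [expSeries, PowerSeries.coeff_rescale, PowerSeries.coeff_exp]
  simp [div_eq_mul_inv]

theorem genSeries_eval (α : ℂ) : genSeries (Polynomial.leval α) = expSeries α := by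
  ext l
  rw [coeff_genSeries, coeff_expSeries]
  simp

/-- This is exp(x(X + α)) = exp(αx) exp(xX); on coefficients it is the binomial theorem. -/
theorem genSeries_taylor (Γ : ℂ[X] →ₗ[ℂ] ℂ) (α : ℂ) :
    genSeries (Γ ∘ₗ taylor α) = expSeries α * genSeries Γ := by
  ext l
  rw [coeff_genSeries, PowerSeries.coeff_mul, LinearMap.comp_apply, taylor_apply, X_pow_comp,
    add_comm, (Commute.all _ _).add_pow', map_sum, Finset.sum_div]
  refine Finset.sum_congr rfl fun m hm => ?_
  obtain ⟨i, j⟩ := m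
  rw [Finset.HasAntidiagonal.mem_antidiagonal] at hm
  dsimp only at hm ⊢
  subst hm
  rw [coeff_expSeries, coeff_genSeries, ← C_pow, ← smul_eq_C_mul, map_nsmul, map_smul]
  have h := Nat.add_choose_mul_factorial_mul_factorial i j
  rw [← Nat.choose_symm_add] at h
  have h' : ((i + j).choose i : ℂ) * (i.factorial : ℂ) * (j.factorial : ℂ) =
    ((i + j).factorial : ℂ) := by exact_mod_cast h
  have h1 := factorial_ne_zero' i
  have h2 := factorial_ne_zero' j
  have h3 := factorial_ne_zero' (i + j)
  rw [nsmul_eq_mul, smul_eq_mul]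
  field_simp
  rw [← h']
  ring

theorem genSeries_neg (Γ : ℂ[X] →ₗ[ℂ] ℂ) :
    genSeries (Γ ∘ₗ (aeval (-X : ℂ[X])).toLinearMap) =
      PowerSeries.rescale (-1 : ℂ) (genSeries Γ) := by
  ext l
  rw [PowerSeries.coeff_rescale, coeff_genSeries, coeff_genSeries]
  simp only [LinearMap.comp_apply, AlgHom.toLinearMap_apply, map_pow, aeval_X]
  rw [neg_pow, show ((-1 : ℂ[X]) ^ l * X ^ l) = ((-1 : ℂ) ^ l) • X ^ l by
    rw [smul_eq_C_mul]; simp, map_smul, smul_eq_mul, mul_div_assoc]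

theorem expSeries_mul_neg (α : ℂ) : expSeries α * expSeries (-α) = 1 := by
  have h := PowerSeries.exp_mul_exp_eq_exp_add (A := ℂ) α (-α)
  rw [add_neg_cancel] at h
  rw [expSeries, expSeries, h]
  ext l
  simp [PowerSeries.coeff_one]

theorem ddx_mul_expSeries (χ : PowerSeries ℂ) (α : ℂ) :
    aeval ddx (X - C α) (χ * expSeries α) = ddx χ * expSeries α := by
  have h : ddx (expSeries α) = α • expSeries α := by
    ext l
    rw [ddx_apply, PowerSeries.coeff_derivative, coeff_expSeries, map_smul, coeff_expSeries,
      Nat.factorial_succ, smul_eq_mul]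
    have := factorial_ne_zero' l
    have : (l : ℂ) + 1 ≠ 0 := Nat.cast_add_one_ne_zero l
    push_cast
    field_simp
    ring
  rw [map_sub, aeval_X, aeval_C, LinearMap.sub_apply, Module.algebraMap_end_apply, ddx_apply,
    Derivation.leibniz, ← ddx_apply, ← ddx_apply, h]
  simp only [smul_eq_mul, mul_smul_comm]
  ring

theorem aeval_ddx_pow_mul_expSeries (n : ℕ) (χ : PowerSeries ℂ) (α : ℂ) :
    aeval ddx ((X - C α) ^ n) (χ * expSeries α) =
      (PowerSeries.derivative ℂ)^[n] χ * expSeries α := by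
  induction n generalizing χ with
  | zero => simp
  | succ n ih =>
    rw [pow_succ, aeval_ddx_mul, ddx_mul_expSeries, ih, Function.iterate_succ_apply,
      ddx_apply]

/-- The operator (d/dx - α)^(deg q + 1) kills q exp(αx), and commuting operators are multiplied to
kill a sum. -/
theorem IsQuasipolynomial.exists_aeval_eq_zero {φ : PowerSeries ℂ} (h : IsQuasipolynomial φ) :
    ∃ B : ℂ[X], B ≠ 0 ∧ aeval ddx B φ = 0 := by
  induction h using Submodule.span_induction with
  | mem φ h =>
    obtain ⟨q, α, rfl⟩ := h
    refine ⟨(X - C α) ^ (q.natDegree + 1), pow_ne_zero _ (X_sub_C_ne_zero α), ?_⟩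
    rw [aeval_ddx_pow_mul_expSeries]
    have (n : ℕ) : (PowerSeries.derivative ℂ)^[n] (q : PowerSeries ℂ) =
        ((derivative^[n] q : ℂ[X]) : PowerSeries ℂ) := by
      induction n with
      | zero => rfl
      | succ n ih =>
        rw [Function.iterate_succ_apply', Function.iterate_succ_apply', ih,
          PowerSeries.derivative_coe]
    rw [this, iterate_derivative_eq_zero (Nat.lt_succ_self _), coe_zero, zero_mul]
  | zero => exact ⟨1, one_ne_zero, map_zero _⟩
  | add φ ψ _ _ h1 h2 =>
    obtain ⟨B, hB, hB'⟩ := h1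
    obtain ⟨D, hD, hD'⟩ := h2
    refine ⟨B * D, mul_ne_zero hB hD, ?_⟩
    rw [map_add, map_mul, Module.End.mul_apply, Module.End.mul_apply, hD', map_zero, add_zero,
      ← Module.End.mul_apply, ← map_mul, mul_comm, map_mul, Module.End.mul_apply, hB', map_zero]
  | smul z φ _ h =>
    obtain ⟨B, hB, hB'⟩ := h
    exact ⟨B, hB, by rw [map_smul, hB', smul_zero]⟩

/-- Conjugation by exp(αx) turns d/dx - α into d/dx, and a series with vanishing n-th derivative
equals its truncation below degree n. -/
theorem isQuasipolynomial_of_aeval_X_sub_C_pow {φ : PowerSeries ℂ} {α : ℂ} {n : ℕ}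
    (h : aeval ddx ((X - C α) ^ n) φ = 0) : IsQuasipolynomial φ := by
  have hφ : φ = φ * expSeries (-α) * expSeries α := by
    rw [mul_assoc, mul_comm (expSeries (-α)), expSeries_mul_neg, mul_one]
  set χ := φ * expSeries (-α)
  have h1 : (PowerSeries.derivative ℂ)^[n] χ = 0 := by
    rw [hφ, aeval_ddx_pow_mul_expSeries] at h
    have := congrArg (· * expSeries (-α)) h
    simpa only [mul_assoc, expSeries_mul_neg, mul_one, zero_mul] using this
  have h2 : χ = ((χ.trunc n : ℂ[X]) : PowerSeries ℂ) := by
    ext l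
    rw [coeff_coe, PowerSeries.coeff_trunc]
    split_ifs with hl
    · rfl
    · obtain ⟨k, rfl⟩ := Nat.exists_eq_add_of_le (not_lt.1 hl)
      have h3 := congrArg (PowerSeries.coeff k) h1
      rw [PowerSeries.coeff_iterate_derivative, map_zero, add_comm k n] at h3
      refine (mul_eq_zero.1 h3).resolve_left ?_
      exact Nat.cast_ne_zero.2 (Nat.ascFactorial_pos _ _).ne'
  refine Submodule.subset_span ⟨χ.trunc n, α, ?_⟩
  rw [← h2]
  exact hφ

/-- Factor B into coprime prime powers: over ℂ each prime is X - α up to a unit, and a Bézout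
identity splits φ accordingly. -/
theorem isQuasipolynomial_of_aeval_eq_zero {B : ℂ[X]} (hB : B ≠ 0) {φ : PowerSeries ℂ}
    (h : aeval ddx B φ = 0) : IsQuasipolynomial φ := by
  induction B using UniqueFactorizationMonoid.induction_on_coprime generalizing φ with
  | h0 => exact absurd rfl hB
  | h1 hu =>
    obtain ⟨u, rfl⟩ := hu
    have h2 : φ = aeval ddx (((u⁻¹ : ℂ[X]ˣ) : ℂ[X]) * (u : ℂ[X])) φ := by simp
    rw [h2, map_mul, Module.End.mul_apply, h, map_zero]
    exact Submodule.zero_mem _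
  | hpr i hp =>
    obtain ⟨α, hα⟩ := IsAlgClosed.exists_root _ (degree_pos_of_irreducible hp.irreducible).ne'
    have ha := ((irreducible_X_sub_C α).associated_of_dvd hp.irreducible
      (dvd_iff_isRoot.2 hα)).symm.pow_pow (n := i)
    obtain ⟨u, hu⟩ := ha
    refine isQuasipolynomial_of_aeval_X_sub_C_pow (α := α) (n := i) ?_
    rw [← hu, mul_comm, map_mul, Module.End.mul_apply, h, map_zero]
  | @hcp x y hxy hx hy =>
    obtain ⟨a, b, hab⟩ := hxy.isCoprime
    -- With a x + b y = 1, the first summand is killed by y and the second by x, because the product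
    -- x y kills φ.
    have h1 : φ = aeval ddx (a * x) φ + aeval ddx (b * y) φ := by
      rw [← LinearMap.add_apply, ← map_add, hab, map_one, Module.End.one_apply]
    rw [h1]
    refine Submodule.add_mem _ (hy (right_ne_zero_of_mul hB) ?_) (hx (left_ne_zero_of_mul hB) ?_)
    · rw [← aeval_ddx_mul, show y * (a * x) = a * (x * y) by ring, aeval_ddx_mul, h, map_zero]
    · rw [← aeval_ddx_mul, show x * (b * y) = b * (x * y) by ring, aeval_ddx_mul, h, map_zero]

/-! ### The highest weight on brackets -/

/-- The hypothesis on q says that it contains only monomials X^l with l + n odd, and A vanishes on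
those. Equivalently, A = (-1)^n A ∘ (X ↦ -X). -/
theorem map_eq_zero_of_parity (A : ℂ[X] →ₗ[ℂ] ℂ) (n : ℕ) (hA : ∀ l, Odd (l + n) → A (X ^ l) = 0)
    {q : ℂ[X]} (hq : ((-1 : ℂ) ^ n) • q.comp (-X) = -q) : A q = 0 := by
  have h : A - ((-1 : ℂ) ^ n) • A ∘ₗ (aeval (-X : ℂ[X])).toLinearMap = 0 := by
    refine Polynomial.lhom_ext' fun l => LinearMap.ext_ring ?_
    simp only [LinearMap.comp_apply, monomial_one_right_eq_X_pow, LinearMap.sub_apply,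
      LinearMap.smul_apply, AlgHom.toLinearMap_apply, map_pow, aeval_X, LinearMap.zero_apply]
    rw [neg_pow (X : ℂ[X]) l, show ((-1 : ℂ[X]) ^ l * X ^ l) = ((-1 : ℂ) ^ l) • X ^ l by
      rw [smul_eq_C_mul]; simp, map_smul, smul_smul, ← pow_add, smul_eq_mul]
    rcases Nat.even_or_odd (l + n) with h | h
    · rw [add_comm n l, h.neg_one_pow, one_mul, sub_self]
    · rw [hA l h, mul_zero, sub_zero]
  have h1 := DFunLike.congr_fun h q
  have h2 : A (((-1 : ℂ) ^ n) • q.comp (-X)) = -A q := by rw [hq, map_neg]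
  rw [map_smul] at h2
  simp only [LinearMap.sub_apply, LinearMap.smul_apply, LinearMap.comp_apply,
    AlgHom.toLinearMap_apply, LinearMap.zero_apply] at h1
  rw [show aeval (-X : ℂ[X]) q = q.comp (-X) from rfl, h2] at h1
  linear_combination h1 / 2

/-- The functional `h ↦ Γ(h(X + 1/2) - h(X - 1/2)) + κ h(-(c + 1)/2)`. -/
noncomputable def diffFunctional (c κ : ℂ) (Γ : ℂ[X] →ₗ[ℂ] ℂ) : ℂ[X] →ₗ[ℂ] ℂ :=
  Γ ∘ₗ taylor (1 / 2) - Γ ∘ₗ taylor (-(1 / 2)) + κ • leval (-((c + 1) / 2))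

/-- This links brackets with the theorem: the first term is the candidate for φ, the second is a
quasipolynomial whatever κ is. -/
theorem genSeries_diffFunctional (c κ : ℂ) (Γ : ℂ[X] →ₗ[ℂ] ℂ) :
    genSeries (diffFunctional c κ Γ) =
      genSeries Γ * twoSinhHalf + κ • expSeries (-((c + 1) / 2)) := by
  rw [diffFunctional, map_add, map_sub, map_smul, genSeries_taylor, genSeries_taylor,
    genSeries_eval, twoSinhHalf, mul_sub, mul_comm (expSeries _), mul_comm (expSeries _)]

theorem diffFunctional_taylor (c κ : ℂ) (Γ : ℂ[X] →ₗ[ℂ] ℂ) (i : ℂ) (H : ℂ[X]) :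
    diffFunctional c κ Γ (taylor ((c + 1) / 2 + i) H) =
      Γ (taylor (c / 2 + (i + 1)) H) - Γ (taylor (c / 2 + i) H) + κ * H.eval i := by
  simp only [diffFunctional, LinearMap.add_apply, LinearMap.sub_apply, LinearMap.comp_apply,
    LinearMap.smul_apply, taylor_taylor, leval_apply, taylor_eval, smul_eq_mul]
  ring_nf

theorem lie_mon_mon (k : ℕ) (F G : ℂ[X]) :
    ⁅incl (mon k F), incl (mon (-k) G)⁆ =
      incl (mon 0 (taylor (-(k : ℂ)) F * G - taylor (k : ℂ) (taylor (-(k : ℂ)) F * G))) +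
      central (∑ i ∈ Finset.range k, (taylor (-(k : ℂ)) F * G).eval (i : ℂ)) := by
  rw [eq_incl_add_central ⁅incl (mon k F), incl (mon (-k) G)⁆]
  congr 2
  · change ⁅mon k F, mon (-k) G⁆ = _
    rw [lie_def, mon_mul_mon, mon_mul_mon, add_neg_cancel, neg_add_cancel, ← map_sub]
    simp only [← taylor_apply, Int.cast_neg, Int.cast_natCast, taylor_mul, taylor_taylor,
      add_neg_cancel, taylor_zero]
    rw [mul_comm F]
  · change psi (mon k F) (mon (-k) G) = _
    rw [psi_mon, if_pos (add_neg_cancel _), neg_neg, Finset.Ico_eq_empty (by omega : ¬ (k : ℤ) < 0),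
      Finset.sum_empty, sub_zero]
    -- Reindex by m = i - k, which moves the range -k ≤ m < 0 to 0 ≤ i < k and F(m) to F(i - k).
    refine Finset.sum_bij' (fun m _ => (m + k).toNat) (fun i _ => (i : ℤ) - k) ?_ ?_ ?_ ?_ ?_
    · intro m hm; simp at hm ⊢; omega
    · intro m hm; simp at hm ⊢; omega
    · intro m hm; simp at hm ⊢; omega
    · intro m hm; simp
    · intro m hm
      rw [Finset.mem_Ico] at hm
      have h : ((m + k).toNat : ℂ) = (m : ℂ) + k := by
        have : ((m + k).toNat : ℤ) = m + k := Int.toNat_of_nonneg (by omega)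
        exact_mod_cast congrArg (Int.cast : ℤ → ℂ) this
      rw [eval_mul, taylor_eval, h]
      push_cast
      congr 2
      ring

variable {p : ℂ[X]} {c : ℂ} {hc : IsSymmetricAbout p c} {s : ℤˣ} {μ : DHat →ₗ[ℂ] ℂ}
  {Γ : ℂ[X] →ₗ[ℂ] ℂ}

/-- The labels with l + deg p odd are all that is known of μ. After centring at c/2, an element of
degree 0 of the subalgebra is p times a polynomial of exactly that parity, so the difference of the
two sides vanishes by `map_eq_zero_of_parity`. -/
theorem map_incl_mon_zero (hp : p ≠ 0)
    (hΓ : ∀ l, Odd (l + p.natDegree) → μ (labelOp p c l) = -Γ (taylor (c / 2) p * X ^ l))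
    {F : ℂ[X]} (hF : mon 0 F ∈ DpSub p c s hc) : μ (incl (mon 0 F)) = -Γ (taylor (c / 2) F) := by
  obtain ⟨f, h1, h2⟩ := exists_coef_of_mem_DpSub hp hF 0
  rw [coef_mon_same] at h1
  subst h1
  let A : ℂ[X] →ₗ[ℂ] ℂ :=
    μ ∘ₗ incl ∘ₗ mon 0 ∘ₗ LinearMap.mulRight ℂ p ∘ₗ taylor (-(c / 2)) +
      Γ ∘ₗ LinearMap.mulLeft ℂ (taylor (c / 2) p)
  have hA : A (taylor (c / 2) f) = 0 := by
    refine map_eq_zero_of_parity A p.natDegree (fun l hl => ?_) ?_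
    · simp only [A, LinearMap.add_apply, LinearMap.comp_apply, LinearMap.mulRight_apply,
        LinearMap.mulLeft_apply, taylor_X_pow]
      have h := hΓ l hl
      rw [labelOp, sub_eq_add_neg, ← C_neg] at h
      rw [eq_neg_iff_add_eq_zero] at h
      exact h
    · have h3 := congrArg (taylor (c / 2)) h2
      simp only [zpow_zero, Units.val_one, Int.cast_one, mul_one, Int.cast_zero, C_0, sub_zero,
        map_smul, map_neg] at h3
      rw [← h3]
      congr 1
      simp only [taylor_apply, comp_assoc, add_comp, X_comp, C_comp, neg_comp]
      congr 1
      rw [show (C c : ℂ[X]) = C (c / 2) + C (c / 2) by rw [← C_add, add_halves]]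
      ring
  simp only [A, LinearMap.add_apply, LinearMap.comp_apply, LinearMap.mulRight_apply,
    LinearMap.mulLeft_apply, taylor_taylor, neg_add_cancel, taylor_zero] at hA
  rw [taylor_mul, mul_comm (taylor (c / 2) f)]
  exact eq_neg_of_add_eq_zero_left hA

/-- The degree 0 part of the bracket is H(D) - H(D + k). It telescopes into unit steps, and the
cocycle supplies the value H(i) needed to complete the i-th step to `diffFunctional`. -/
theorem map_lie_mon_mon (hp : p ≠ 0)
    (hΓ : ∀ l, Odd (l + p.natDegree) → μ (labelOp p c l) = -Γ (taylor (c / 2) p * X ^ l))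
    (k : ℕ) {F G : ℂ[X]} (hF : mon k F ∈ DpSub p c s hc) (hG : mon (-k) G ∈ DpSub p c s hc) :
    μ ⁅incl (mon k F), incl (mon (-k) G)⁆ = ∑ i ∈ Finset.range k,
      diffFunctional c (μ (central 1)) Γ
        (taylor ((c + 1) / 2 + (i : ℂ)) (taylor (-(k : ℂ)) F * G)) := by
  have hmem : ⁅incl (mon k F), incl (mon (-k) G)⁆ ∈ DpHat p c s hc :=
    (DpHat p c s hc).lie_mem (x := incl (mon k F)) (y := incl (mon (-k) G)) hF hG
  rw [lie_mon_mon] at hmem ⊢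
  set H := taylor (-(k : ℂ)) F * G
  have hmem' : mon 0 (H - taylor (k : ℂ) H) ∈ DpSub p c s hc := by
    have h1 : (incl (mon 0 (H - taylor (k : ℂ) H)) +
      central (∑ i ∈ Finset.range k, H.eval (i : ℂ))).1 ∈ DpSub p c s hc := hmem
    have h2 : (incl (mon 0 (H - taylor (k : ℂ) H)) +
      central (∑ i ∈ Finset.range k, H.eval (i : ℂ))).1 = mon 0 (H - taylor (k : ℂ) H) :=
      add_zero _
    rwa [h2] at h1
  have hz (z : ℂ) : μ (central z) = μ (central 1) * z := by
    rw [mul_comm, ← smul_eq_mul, ← map_smul, ← map_smul, smul_eq_mul, mul_one]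
  rw [map_add, map_incl_mon_zero hp hΓ hmem', hz, Finset.mul_sum]
  simp only [diffFunctional_taylor]
  rw [Finset.sum_add_distrib]
  have := Finset.sum_range_sub (fun i : ℕ => Γ (taylor (c / 2 + (i : ℂ)) H)) k
  push_cast at this
  rw [this, map_sub, map_sub, taylor_taylor, add_zero]
  ring

theorem map_labelOp_of_labelSeries_eq {lam : Module.Dual ℂ (grading p c s hc 0)}
    (hμ : ∀ h : grading p c s hc 0, μ (h : DpHat p c s hc) = lam h)
    (h : labelSeries p c s hc lam = shiftedOp p c (genSeries Γ)) (l : ℕ)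
    (hl : Odd (l + p.natDegree)) : μ (labelOp p c l) = -Γ (taylor (c / 2) p * X ^ l) := by
  have h1 := congrArg (PowerSeries.coeff l) h
  rw [shiftedOp_eq, aeval_ddx_genSeries, coeff_genSeries, labelSeries, PowerSeries.coeff_mk,
    dif_pos hl, ← hμ, div_left_inj' (factorial_ne_zero' l)] at h1
  rw [taylor_apply, ← neg_eq_iff_eq_neg]
  exact h1

/-! ### Sufficiency -/

theorem exists_finite_complement {V W : Type*} [AddCommGroup V] [Module ℂ V] [AddCommGroup W]
    [Module ℂ W] [FiniteDimensional ℂ W] (A : Submodule ℂ V) (T : V →ₗ[ℂ] W) :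
    ∃ Q ≤ A, FiniteDimensional ℂ Q ∧ A ≤ Q ⊔ (A ⊓ LinearMap.ker T) := by
  obtain ⟨Q, hQ⟩ := Submodule.exists_isCompl (LinearMap.ker (T ∘ₗ A.subtype))
  refine ⟨Q.map A.subtype, Submodule.map_subtype_le A Q, ?_, fun x hx => ?_⟩
  · have hinj : Function.Injective ((T ∘ₗ A.subtype) ∘ₗ Q.subtype) := by
      rw [← LinearMap.ker_eq_bot, LinearMap.ker_comp, ← Submodule.disjoint_iff_comap_eq_bot]
      exact hQ.symm.disjoint
    have : FiniteDimensional ℂ Q := FiniteDimensional.of_injective _ hinj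
    infer_instance
  · have h : (⟨x, hx⟩ : A) ∈ LinearMap.ker (T ∘ₗ A.subtype) ⊔ Q :=
      hQ.sup_eq_top ▸ Submodule.mem_top
    obtain ⟨y, hy, q, hq, hyq⟩ := Submodule.mem_sup.1 h
    have hx' : (y : V) + (q : V) = x := congrArg Subtype.val hyq
    rw [← hx', add_comm]
    exact Submodule.add_mem_sup ⟨q, hq, rfl⟩ ⟨y.2, hy⟩

/-- The product `∏ i < k, b(X - i)`. -/
noncomputable def shiftProd (b : ℂ[X]) (k : ℕ) : ℂ[X] :=
  ∏ i ∈ Finset.range k, taylor (-(i : ℂ)) b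

theorem shiftProd_ne_zero {b : ℂ[X]} (hb : b ≠ 0) (k : ℕ) : shiftProd b k ≠ 0 :=
  Finset.prod_ne_zero_iff.2 fun _ _ h => hb ((taylor_eq_zero _ _).1 h)

theorem shiftProd_dvd (b : ℂ[X]) (m j : ℕ) : shiftProd b m ∣ shiftProd b (m + j) := by
  rw [shiftProd, shiftProd, Finset.prod_range_add]
  exact dvd_mul_right _ _

theorem taylor_dvd_taylor {f g : ℂ[X]} (r : ℂ) (h : f ∣ g) : taylor r f ∣ taylor r g := by
  obtain ⟨q, rfl⟩ := h
  rw [taylor_mul]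
  exact dvd_mul_right _ _

/-- Shifting by j turns the last m factors of the longer product into the shorter product. Together
with `shiftProd_dvd` this handles the two terms of the commutator. -/
theorem shiftProd_dvd_taylor (b : ℂ[X]) (m j : ℕ) :
    shiftProd b m ∣ taylor (j : ℂ) (shiftProd b (m + j)) := by
  rw [add_comm m j]
  have h : (∏ i ∈ Finset.range m, taylor (-((j + i : ℕ) : ℂ)) b) ∣ shiftProd b (j + m) := by
    rw [shiftProd, Finset.prod_range_add]
    exact dvd_mul_left _ _
  have h2 : taylor (j : ℂ) (∏ i ∈ Finset.range m, taylor (-((j + i : ℕ) : ℂ)) b) =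
      shiftProd b m := by
    change taylorAlgHom (j : ℂ) _ = _
    rw [map_prod]
    refine Finset.prod_congr rfl fun i _ => ?_
    change taylor (j : ℂ) (taylor _ b) = _
    rw [taylor_taylor]
    push_cast
    ring_nf
  rw [← h2]
  exact taylor_dvd_taylor _ h

theorem dvd_taylor_shiftProd (b : ℂ[X]) {k i : ℕ} (hi : i < k) :
    b ∣ taylor (i : ℂ) (shiftProd b k) := by
  have h : taylor (-(i : ℂ)) b ∣ shiftProd b k := Finset.dvd_prod_of_mem _ (Finset.mem_range.2 hi)
  have h2 := taylor_dvd_taylor (i : ℂ) h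
  rwa [taylor_taylor, add_neg_cancel, taylor_zero] at h2

theorem coef_lie_mon (j k : ℤ) (F G : ℂ[X]) : coef (j + k) ⁅mon j F, mon k G⁆ =
    taylor (k : ℂ) F * G - taylor (j : ℂ) G * F := by
  rw [lie_def, mon_mul_mon, mon_mul_mon, add_comm k j, ← map_sub, coef_mon_same, taylor_apply,
    taylor_apply]

variable {p : ℂ[X]} {c : ℂ} {hc : IsSymmetricAbout p c} {s : ℤˣ}
  {lam : Module.Dual ℂ (grading p c s hc 0)}

/-- In degree k < 0 the family P consists of the operators whose coefficient is divisible by `d k`.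
The shifts in `shiftProd` are exactly those that make every summand of `map_lie_mon_mon` a multiple
of B. -/
theorem isQuasifinite_of_diffFunctional (hp : p ≠ 0) {μ : DHat →ₗ[ℂ] ℂ}
    (hμ : ∀ h : grading p c s hc 0, μ (h : DpHat p c s hc) = lam h) {Γ : ℂ[X] →ₗ[ℂ] ℂ}
    (hΓ : ∀ l, Odd (l + p.natDegree) → μ (labelOp p c l) = -Γ (taylor (c / 2) p * X ^ l))
    {B : ℂ[X]} (hB : B ≠ 0) (hBΓ : ∀ q, diffFunctional c (μ (central 1)) Γ (B * q) = 0) :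
    IsQuasifinite (grading p c s hc) lam := by
  obtain ⟨E, hE⟩ := exists_isHighestWeightFunctional hp hc s lam
  -- The shift undoes the (c + 1)/2 in `map_lie_mon_mon`.
  set b : ℂ[X] := taylor (-((c + 1) / 2)) B with hb
  have hb0 : b ≠ 0 := fun h => hB ((taylor_eq_zero _ _).1 h)
  let d : ℤ → ℂ[X] := fun k => shiftProd b (-k).toNat * p
  -- Divisibility by `d k` is the kernel of a map to ℂ[X]/(d k), which is finite-dimensional because
  -- `d k` is nonzero; this gives the finite codimension of P.
  let T : ∀ k : ℤ, DpHat p c s hc →ₗ[ℂ] AdjoinRoot (d k) := fun k =>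
    (AdjoinRoot.mkₐ (d k) : ℂ[X] →ₐ[ℂ] _).toLinearMap ∘ₗ coef k ∘ₗ proj.toLinearMap ∘ₗ
      (DpHat p c s hc).toSubmodule.subtype
  have hT (k : ℤ) (x : DpHat p c s hc) : x ∈ LinearMap.ker (T k) ↔ d k ∣ coef k x.1.1 := by
    rw [LinearMap.mem_ker]
    exact AdjoinRoot.mk_eq_zero
  refine hE.isQuasifinite (P := fun k => grading p c s hc k ⊓ LinearMap.ker (T k))
    (fun k => inf_le_left) ?_ ?_ fun k _ => ?_
  · rintro j k hj hjk y hy x ⟨hx, hxT⟩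
    refine ⟨hE.lie_mem hy hx, ?_⟩
    rw [SetLike.mem_coe, hT] at hxT ⊢
    obtain ⟨⟨F, hF⟩, -⟩ := hy
    obtain ⟨⟨G, hG⟩, -⟩ := hx
    have hF' : y.1.1 = mon j F := hF
    have hG' : x.1.1 = mon k G := hG
    change _ ∣ coef (j + k) ⁅y.1.1, x.1.1⁆
    obtain ⟨f, hf, -⟩ := exists_coef_of_mem_DpSub hp (show y.1.1 ∈ DpSub p c s hc from y.2) j
    rw [hF', coef_mon_same] at hf
    rw [hG', coef_mon_same] at hxT
    rw [hF', hG', coef_lie_mon]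
    obtain ⟨j, rfl⟩ := Int.eq_ofNat_of_zero_le hj
    obtain ⟨m, hm⟩ : ∃ m : ℕ, j + k = -(m : ℤ) := ⟨(-(j + k)).toNat, by omega⟩
    have h1 : d (j + k) = shiftProd b m * p := by simp only [d, hm, neg_neg, Int.toNat_natCast]
    have h2 : d k = shiftProd b (m + j) * p := by
      simp only [d]; rw [show (-k).toNat = m + j by omega]
    rw [h1]
    rw [h2] at hxT
    -- In the first term G carries all of `d (j + k)`. In the second the factor p comes from F, and
    -- the shifted product from G(X + j).
    refine dvd_sub ?_ ?_
    · exact Dvd.dvd.mul_left ((mul_dvd_mul_right (shiftProd_dvd b m j) p).trans hxT) _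
    · rw [hf]
      refine mul_dvd_mul ?_ (dvd_mul_left _ _)
      exact (shiftProd_dvd_taylor b m j).trans
        (taylor_dvd_taylor _ ((dvd_mul_right _ _).trans hxT))
  · rintro j k hj hjk y hy x ⟨hx, hxT⟩ h
    rw [SetLike.mem_coe, hT] at hxT
    obtain ⟨F, z, hz, hF⟩ := exists_of_mem_hatGrade hy
    obtain ⟨G, w, hw, hG⟩ := exists_of_mem_hatGrade hx
    obtain ⟨j, rfl⟩ := Int.eq_ofNat_of_zero_le hj.le
    obtain rfl : k = -(j : ℤ) := by omega
    rw [hz hj.ne'] at hF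
    rw [hw (by omega)] at hG
    have hF' : y.1 = incl (mon j F) := hF
    have hG' : x.1 = incl (mon (-(j : ℤ)) G) := hG
    have hFm : mon j F ∈ DpSub p c s hc := by
      have h1 : y.1.1 ∈ DpSub p c s hc := y.2
      rwa [hF'] at h1
    have hGm : mon (-(j : ℤ)) G ∈ DpSub p c s hc := by
      have h1 : x.1.1 ∈ DpSub p c s hc := x.2
      rwa [hG'] at h1
    rw [← hμ]
    change μ ⁅y.1, x.1⁆ = 0
    rw [hF', hG', map_lie_mon_mon hp hΓ j hFm hGm]
    refine Finset.sum_eq_zero fun i hi => ?_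
    have h1 : shiftProd b j ∣ G := by
      have h2 : d (-(j : ℤ)) ∣ coef (-(j : ℤ)) (mon (-(j : ℤ)) G) := by
        rw [hG'] at hxT; exact hxT
      rw [coef_mon_same] at h2
      simp only [d, neg_neg, Int.toNat_natCast] at h2
      exact (dvd_mul_right _ _).trans h2
    have h2 : B ∣ taylor ((c + 1) / 2 + (i : ℂ)) (taylor (-(j : ℂ)) F * G) := by
      have h3 := taylor_dvd_taylor ((c + 1) / 2)
        ((dvd_taylor_shiftProd b (Finset.mem_range.1 hi)).trans (taylor_dvd_taylor (i : ℂ) h1))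
      rw [hb, taylor_taylor, taylor_taylor, add_neg_cancel, taylor_zero] at h3
      rw [taylor_mul]
      exact Dvd.dvd.mul_left h3 _
    obtain ⟨q, hq⟩ := h2
    rw [hq]
    exact hBΓ q
  · have hd : d k ≠ 0 := mul_ne_zero (shiftProd_ne_zero hb0 _) hp
    have : FiniteDimensional ℂ (AdjoinRoot (d k)) := (AdjoinRoot.powerBasis hd).finite
    exact exists_finite_complement _ (T k)

theorem map_mul_eq_zero_of_aeval_ddx {Γ : ℂ[X] →ₗ[ℂ] ℂ} {B : ℂ[X]}
    (h : aeval ddx B (genSeries Γ) = 0) (q : ℂ[X]) : Γ (B * q) = 0 := by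
  have h0 : Γ ∘ₗ LinearMap.mulLeft ℂ B = 0 := by
    refine Polynomial.lhom_ext' fun l => LinearMap.ext_ring ?_
    rw [aeval_ddx_genSeries] at h
    have h1 := congrArg (PowerSeries.coeff l) h
    rw [coeff_genSeries, map_zero, div_eq_zero_iff] at h1
    have := h1.resolve_right (factorial_ne_zero' l)
    rw [LinearMap.comp_apply, monomial_one_right_eq_X_pow]
    exact this
  exact DFunLike.congr_fun h0 q

/-- Adding the central exponential to φ keeps it a quasipolynomial, so a nonzero B(d/dx) kills the
series of `diffFunctional`, which therefore vanishes on (B). -/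
theorem isQuasifinite_of_labelSeries (hp : p ≠ 0) {G : PowerSeries ℂ}
    (hq : IsQuasipolynomial (G * twoSinhHalf))
    (hG : labelSeries p c s hc lam = shiftedOp p c G) :
    IsQuasifinite (grading p c s hc) lam := by
  obtain ⟨Γ, rfl⟩ := genSeries_surjective G
  obtain ⟨μ, hμ⟩ := exists_extension hc s lam
  have hexp : IsQuasipolynomial (expSeries (-((c + 1) / 2))) :=
    Submodule.subset_span ⟨1, _, by rw [coe_one, one_mul]⟩
  obtain ⟨B, hB, hB'⟩ := IsQuasipolynomial.exists_aeval_eq_zero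
    (Submodule.add_mem _ hq (Submodule.smul_mem _ (μ (central 1)) hexp))
  rw [← genSeries_diffFunctional] at hB'
  exact isQuasifinite_of_diffFunctional hp hμ (map_labelOp_of_labelSeries_eq hμ hG) hB
    (map_mul_eq_zero_of_aeval_ddx hB')

/-! ### Necessity -/

/-- The polynomial `X ^ e * u(X ^ 2)`. -/
noncomputable def parityPoly (e : ℕ) : ℂ[X] →ₗ[ℂ] ℂ[X] :=
  LinearMap.mulLeft ℂ (X ^ e) ∘ₗ (expand ℂ 2).toLinearMap

theorem parityPoly_apply (e : ℕ) (u : ℂ[X]) : parityPoly e u = X ^ e * expand ℂ 2 u := rfl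

theorem expand_two_comp_neg (u : ℂ[X]) : (expand ℂ 2 u).comp (-X) = expand ℂ 2 u := by
  rw [expand_eq_comp_X_pow, comp_assoc, X_pow_comp, neg_sq]

theorem parityPoly_comp_neg (e : ℕ) (u : ℂ[X]) :
    (parityPoly e u).comp (-X) = ((-1 : ℂ) ^ e) • parityPoly e u := by
  rw [parityPoly_apply, mul_comp, expand_two_comp_neg, X_pow_comp, neg_pow (X : ℂ[X]) e,
    smul_eq_C_mul]
  simp [mul_assoc]

variable {p : ℂ[X]} {c : ℂ} {hc : IsSymmetricAbout p c} {s : ℤˣ}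
  {lam : Module.Dual ℂ (grading p c s hc 0)}

/-- This e is the parity that the anti-involution imposes on coefficients in degrees ±1. -/
theorem exists_parity (n : ℕ) (s : ℤˣ) :
    ∃ e : ℕ, ((-1) ^ n * ((s : ℤ) : ℂ)) * (-1) ^ e = -1 := by
  rcases Int.units_eq_one_or s with rfl | rfl
  · exact ⟨n + 1, by rw [pow_succ]; simp [← mul_pow]⟩
  · exact ⟨n, by simp [← mul_pow]⟩

/-- The reflection X ↦ -X - k + c fixes (c - k)/2; centred there it becomes X ↦ -X, and the
condition of the subalgebra becomes parity e. -/
theorem mon_parityPoly_mem (hc : IsSymmetricAbout p c) {e : ℕ}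
    (he : ((-1) ^ p.natDegree * ((s : ℤ) : ℂ)) * (-1) ^ e = -1) {k : ℤ} (hk : s ^ k = s)
    (u : ℂ[X]) :
    mon k (taylor (-((c - k) / 2)) (parityPoly e u) * p) ∈ DpSub p c s hc := by
  refine mon_mem_DpSub hc ?_
  have h : (taylor (-((c - k) / 2)) (parityPoly e u)).comp (-X - C (k : ℂ) + C c) =
      taylor (-((c - k) / 2)) ((parityPoly e u).comp (-X)) := by
    rw [taylor_apply, taylor_apply, comp_assoc, comp_assoc]
    congr 1
    simp only [add_comp, neg_comp, X_comp, C_comp]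
    have : (C c : ℂ[X]) = C (c / 2) + C (c / 2) := by rw [← C_add, add_halves]
    have h2 : (C (k : ℂ) : ℂ[X]) = C ((k : ℂ) / 2) + C ((k : ℂ) / 2) := by rw [← C_add, add_halves]
    rw [sub_div, C_neg, C_sub, this, h2]
    ring
  rw [h, hk, parityPoly_comp_neg, map_smul, smul_smul, he, neg_one_smul]

theorem taylor_comp_neg (hc : IsSymmetricAbout p c) (a : ℂ) :
    (taylor (c / 2 + a) p).comp (-X) = (-1) ^ p.natDegree * taylor (c / 2 - a) p := by
  conv_lhs => rw [show p = (-1) ^ p.natDegree * p.comp (-X + C c) from hc]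
  simp only [taylor_apply, mul_comp, pow_comp, neg_comp, one_comp, comp_assoc, add_comp, X_comp,
    C_comp]
  congr 2
  have : (C c : ℂ[X]) = C (c / 2) + C (c / 2) := by rw [← C_add, add_halves]
  rw [C_add, C_sub, this]
  ring

theorem rescale_expSeries (α : ℂ) :
    PowerSeries.rescale (-1 : ℂ) (expSeries α) = expSeries (-α) := by
  ext l
  rw [PowerSeries.coeff_rescale, coeff_expSeries, coeff_expSeries, neg_pow α l, mul_div_assoc]

theorem rescale_smul_expSeries (κ α : ℂ) :
    PowerSeries.rescale (-1 : ℂ) (κ • expSeries α) = κ • expSeries (-α) := by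
  rw [← rescale_expSeries]
  ext l
  simp only [PowerSeries.coeff_rescale, map_smul, smul_eq_mul]
  ring

theorem rescale_twoSinhHalf : PowerSeries.rescale (-1 : ℂ) twoSinhHalf = -twoSinhHalf := by
  rw [twoSinhHalf, map_sub, rescale_expSeries, rescale_expSeries, neg_neg, neg_sub]

theorem constantCoeff_twoSinhHalf : PowerSeries.constantCoeff twoSinhHalf = 0 := by
  rw [twoSinhHalf, map_sub, ← PowerSeries.coeff_zero_eq_constantCoeff_apply,
    ← PowerSeries.coeff_zero_eq_constantCoeff_apply, coeff_expSeries, coeff_expSeries]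
  simp

/-- The label series has an odd preimage under `p(d/dx + c/2)`. -/
theorem exists_odd_preimage (hp : p ≠ 0) :
    ∃ Γ : ℂ[X] →ₗ[ℂ] ℂ, labelSeries p c s hc lam = shiftedOp p c (genSeries Γ) ∧
      PowerSeries.rescale (-1 : ℂ) (genSeries Γ) = -genSeries Γ := by
  obtain ⟨Λ, hΛ⟩ := genSeries_surjective (labelSeries p c s hc lam)
  set P : ℂ[X] := taylor (c / 2) p with hP
  have hP0 : P ≠ 0 := fun h => hp ((taylor_eq_zero _ _).1 h)
  have hPneg : P.comp (-X) = (-1) ^ p.natDegree * P := by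
    have := taylor_comp_neg hc 0
    rwa [add_zero, sub_zero] at this
  -- Multiplication by P is injective, so Λ ∘ g solves P(d/dx) G = Δ_λ.
  obtain ⟨g, hg⟩ := LinearMap.exists_leftInverse_of_injective (LinearMap.mulLeft ℂ P)
    (LinearMap.ker_eq_bot.2 fun a b h => mul_left_cancel₀ hP0 h)
  have hg' (q : ℂ[X]) : g (P * q) = q := DFunLike.congr_fun hg q
  let ν : ℂ[X] →ₗ[ℂ] ℂ[X] := (aeval (-X : ℂ[X])).toLinearMap
  have hν (q : ℂ[X]) : ν q = q.comp (-X) := rfl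
  -- The odd part of that solution is again a solution: P has the parity of deg p, and Δ_λ only has
  -- exponents of the opposite parity.
  refine ⟨(1 / 2 : ℂ) • (Λ ∘ₗ g - (Λ ∘ₗ g) ∘ₗ ν), ?_, ?_⟩
  · rw [shiftedOp_eq, aeval_ddx_genSeries, ← hΛ, ← taylor_apply]
    congr 1
    refine Polynomial.lhom_ext' fun l => LinearMap.ext_ring ?_
    have h1 : ν (P * X ^ l) = ((-1 : ℂ) ^ (l + p.natDegree)) • (P * X ^ l) := by
      rw [hν, mul_comp, hPneg, X_pow_comp, neg_pow (X : ℂ[X]) l, smul_eq_C_mul]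
      simp only [C_pow, C_neg, C_1]
      ring
    simp only [LinearMap.comp_apply, monomial_one_right_eq_X_pow, LinearMap.smul_apply,
      LinearMap.sub_apply, LinearMap.mulLeft_apply]
    rw [← hP, h1, map_smul, map_smul, hg']
    rcases Nat.even_or_odd (l + p.natDegree) with h | h
    · have h2 : Λ (X ^ l) = 0 := by
        have h3 := congrArg (PowerSeries.coeff l) hΛ
        rw [coeff_genSeries, labelSeries, PowerSeries.coeff_mk,
          dif_neg (Nat.not_odd_iff_even.2 h), div_eq_zero_iff] at h3
        exact h3.resolve_right (factorial_ne_zero' l)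
      rw [h2]
      simp
    · rw [h.neg_one_pow, smul_eq_mul, smul_eq_mul]
      ring
  · rw [← genSeries_neg, ← map_neg]
    congr 1
    refine LinearMap.ext fun q => ?_
    change (1 / 2 : ℂ) • (Λ (g (ν q)) - Λ (g (ν (ν q)))) =
      -((1 / 2 : ℂ) • (Λ (g q) - Λ (g (ν q))))
    rw [hν (ν q), hν, comp_assoc, neg_comp, X_comp, neg_neg, comp_X, ← smul_neg, neg_sub]

/-- Only degrees ±1 are used, where the bracket formula has a single summand. The space of u is
infinite-dimensional, so `exists_lam_lie_eq_zero` gives a nonzero u, and r ranges over the elements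
of degree 1 to bracket with. -/
theorem exists_diffFunctional_eq_zero (hp : p ≠ 0) {μ : DHat →ₗ[ℂ] ℂ}
    (hμ : ∀ h : grading p c s hc 0, μ (h : DpHat p c s hc) = lam h) {Γ : ℂ[X] →ₗ[ℂ] ℂ}
    (hΓ : ∀ l, Odd (l + p.natDegree) → μ (labelOp p c l) = -Γ (taylor (c / 2) p * X ^ l))
    (hq : IsQuasifinite (grading p c s hc) lam) :
    ∃ D : ℂ[X], D ≠ 0 ∧ D.comp (-X) = D ∧
      ∀ r, diffFunctional c (μ (central 1)) Γ (D * expand ℂ 2 r) = 0 := by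
  obtain ⟨E, hE⟩ := exists_isHighestWeightFunctional hp hc s lam
  obtain ⟨e, he⟩ := exists_parity p.natDegree s
  have hneg (u : ℂ[X]) : mon (-1) (taylor (-((c + 1) / 2)) (parityPoly e u) * p) ∈
      DpSub p c s hc := by
    have := mon_parityPoly_mem hc he (k := -1) (by rw [zpow_neg_one, Int.units_inv_eq_self]) u
    rwa [Int.cast_neg, Int.cast_one, sub_neg_eq_add] at this
  have hpos (u : ℂ[X]) : mon 1 (taylor (-((c - 1) / 2)) (parityPoly e u) * p) ∈
      DpSub p c s hc := by
    have := mon_parityPoly_mem hc he (k := 1) (zpow_one s) u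
    rwa [Int.cast_one] at this
  let F : ℂ[X] →ₗ[ℂ] DpHat p c s hc := LinearMap.codRestrict (DpHat p c s hc).toSubmodule
    (incl ∘ₗ mon (-1) ∘ₗ LinearMap.mulRight ℂ p ∘ₗ taylor (-((c + 1) / 2)) ∘ₗ parityPoly e) hneg
  have hF (u : ℂ[X]) : F u ∈ grading p c s hc (-1) := incl_mon_mem (-1) _
  obtain ⟨u, hu0, hu⟩ := hE.exists_lam_lie_eq_zero hq one_pos Polynomial.not_finite F hF
  -- The two factors p of the bracket, after the shifts; the symmetry of p exchanges them up to
  -- signs that cancel, so w is even.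
  set w : ℂ[X] := taylor (c / 2 + -(1 / 2)) p * taylor (c / 2 + 1 / 2) p with hw
  have hw0 : w ≠ 0 := mul_ne_zero (fun h => hp ((taylor_eq_zero _ _).1 h))
    (fun h => hp ((taylor_eq_zero _ _).1 h))
  have hwneg : w.comp (-X) = w := by
    have hsq : ((-1 : ℂ[X]) ^ p.natDegree) * (-1) ^ p.natDegree = 1 := by
      rw [← mul_pow]; simp
    rw [hw, mul_comp, taylor_comp_neg hc, taylor_comp_neg hc, sub_neg_eq_add, ← sub_eq_add_neg]
    linear_combination (taylor (c / 2 - 1 / 2) p * taylor (c / 2 + 1 / 2) p) * hsq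
  refine ⟨w * (X ^ 2) ^ e * expand ℂ 2 u, ?_, ?_, fun r => ?_⟩
  · refine mul_ne_zero (mul_ne_zero hw0 (pow_ne_zero _ (pow_ne_zero _ X_ne_zero))) ?_
    rwa [Ne, expand_eq_zero two_pos]
  · rw [mul_comp, mul_comp, hwneg, expand_two_comp_neg, pow_comp, X_pow_comp, neg_sq]
  · let y : DpHat p c s hc := ⟨incl (mon 1 (taylor (-((c - 1) / 2)) (parityPoly e r) * p)), hpos r⟩
    have hy : y ∈ grading p c s hc 1 := incl_mon_mem 1 _
    have hmem : ⁅y, F u⁆ ∈ grading p c s hc 0 := by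
      have h := grading_lie_mem hc s hy (hF u)
      rwa [add_neg_cancel] at h
    have hyu := hu y hy hmem
    rw [← hμ] at hyu
    have hl := map_lie_mon_mon hp hΓ 1
      (F := taylor (-((c - 1) / 2)) (parityPoly e r) * p)
      (G := taylor (-((c + 1) / 2)) (parityPoly e u) * p)
      (by rw [Nat.cast_one]; exact hpos r) (by rw [Nat.cast_one]; exact hneg u)
    simp only [Nat.cast_one, Finset.sum_range_one, Nat.cast_zero, add_zero] at hl
    have hyu' : μ ⁅incl (mon 1 (taylor (-((c - 1) / 2)) (parityPoly e r) * p)),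
      incl (mon (-1) (taylor (-((c + 1) / 2)) (parityPoly e u) * p))⁆ = 0 := hyu
    rw [← hyu', hl]
    congr 1
    -- The shift by (c + 1)/2 centres both parity polynomials at 0, where their product is X^(2e)
    -- u(X²) r(X²).
    rw [taylor_mul, taylor_mul, taylor_mul, taylor_mul]
    simp only [taylor_taylor]
    rw [show (c + 1) / 2 + (-1 + -((c - 1) / 2)) = 0 by ring,
      show (c + 1) / 2 + -((c + 1) / 2) = 0 by ring, taylor_zero, taylor_zero,
      show (c + 1) / 2 + -1 = c / 2 + -(1 / 2) by ring,
      show (c + 1) / 2 = c / 2 + 1 / 2 by ring, parityPoly_apply, parityPoly_apply, hw]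
    ring

/-- The odd preimage makes φ even, being a product of two odd series, and φ(0) = 0 because sinh(0) =
0. Only the quasipolynomial property uses quasifiniteness. -/
theorem exists_quasipolynomial (hp : p ≠ 0) (hq : IsQuasifinite (grading p c s hc) lam) :
    ∃ φ : PowerSeries ℂ, IsQuasipolynomial φ ∧ IsEvenSeries φ ∧
      PowerSeries.constantCoeff φ = 0 ∧ ∃ G : PowerSeries ℂ, G * twoSinhHalf = φ ∧
        labelSeries p c s hc lam = shiftedOp p c G := by
  obtain ⟨Γ, hΓ, hodd⟩ := exists_odd_preimage (s := s) (hc := hc) (lam := lam) hp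
  obtain ⟨μ, hμ⟩ := exists_extension hc s lam
  obtain ⟨D, hD0, hDneg, hD⟩ := exists_diffFunctional_eq_zero hp hμ
    (map_labelOp_of_labelSeries_eq hμ hΓ) hq
  have heven : PowerSeries.rescale (-1 : ℂ) (genSeries Γ * twoSinhHalf) =
      genSeries Γ * twoSinhHalf := by
    rw [map_mul, hodd, rescale_twoSinhHalf, neg_mul_neg]
  refine ⟨genSeries Γ * twoSinhHalf, ?_, heven, ?_, genSeries Γ, rfl, hΓ⟩
  · set κ := μ (central 1)
    set Φ := diffFunctional c κ Γ with hΦ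
    -- The relations Θ(D q) = 0 are available only for even q. Since D is even, the symmetrization
    -- of Θ kills D times every monomial: even ones by these relations, odd ones by cancellation.
    have hzero : aeval ddx D (genSeries (Φ + Φ ∘ₗ (aeval (-X : ℂ[X])).toLinearMap)) = 0 := by
      rw [aeval_ddx_genSeries, ← map_zero genSeries]
      congr 1
      refine Polynomial.lhom_ext' fun l => LinearMap.ext_ring ?_
      simp only [LinearMap.comp_apply, monomial_one_right_eq_X_pow, LinearMap.add_apply,
        LinearMap.mulLeft_apply, LinearMap.zero_apply]
      rw [show (aeval (-X : ℂ[X])).toLinearMap (D * X ^ l) = (D * X ^ l).comp (-X) from rfl,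
        mul_comp, hDneg, X_pow_comp]
      rcases Nat.even_or_odd' l with ⟨m, rfl | rfl⟩
      · have h := hD (X ^ m)
        rw [map_pow, expand_X, ← pow_mul] at h
        rw [pow_mul (-X : ℂ[X]), neg_sq, ← pow_mul, h, add_zero]
      · rw [Odd.neg_pow ⟨m, rfl⟩, mul_neg, map_neg, add_neg_cancel]
    have h1 := isQuasipolynomial_of_aeval_eq_zero hD0 hzero
    -- As φ is even, the symmetrized series is 2φ plus two exponentials; subtracting these and
    -- halving recovers φ.
    rw [map_add, genSeries_neg, hΦ, genSeries_diffFunctional, map_add, heven,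
      rescale_smul_expSeries] at h1
    have hexp (α : ℂ) : IsQuasipolynomial (expSeries α) :=
      Submodule.subset_span ⟨1, _, by rw [coe_one, one_mul]⟩
    have h2 := Submodule.smul_mem _ (1 / 2 : ℂ) (Submodule.sub_mem _
      (Submodule.sub_mem _ h1 (Submodule.smul_mem _ κ (hexp (-((c + 1) / 2)))))
      (Submodule.smul_mem _ κ (hexp (- -((c + 1) / 2)))))
    have h3 (a b d : PowerSeries ℂ) : (1 / 2 : ℂ) • (a + b + (a + d) - b - d) = a := by
      rw [show a + b + (a + d) - b - d = (2 : ℂ) • a by rw [two_smul]; abel, smul_smul]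
      norm_num
    rwa [h3] at h2
  · rw [map_mul, constantCoeff_twoSinhHalf, mul_zero]

end CircleOp

theorem mainTheorem2 (p : ℂ[X]) (hp : p ≠ 0) (c : ℂ) (hc : CircleOp.IsSymmetricAbout p c)
    (s : ℤˣ) (lam : Module.Dual ℂ (CircleOp.grading p c s hc 0)) :
    CircleOp.IsQuasifinite (CircleOp.grading p c s hc) lam ↔
      ∃ φ : PowerSeries ℂ, CircleOp.IsQuasipolynomial φ ∧ CircleOp.IsEvenSeries φ ∧
        PowerSeries.constantCoeff φ = 0 ∧
        ∃ G : PowerSeries ℂ, G * CircleOp.twoSinhHalf = φ ∧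
          CircleOp.labelSeries p c s hc lam = CircleOp.shiftedOp p c G := by
  refine ⟨CircleOp.exists_quasipolynomial hp, ?_⟩
  rintro ⟨_, hφ, -, -, G, rfl, hG⟩
  exact CircleOp.isQuasifinite_of_labelSeries hp hφ hG
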